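/- Let $G$ be a finite simple graph with vertex set $\mathsf V$ and edge set $\mathsf E$, $n=|\mathsf V|$, $m=|\mathsf E|$, in which every vertex $\mathsf v$ has degree $d_{\mathsf v}\ge 1$. Each edge $\mathsf e$ has a length $\ell_{\mathsf e}\in(0,\infty)$ and is parametrized by $[0,\ell_{\mathsf e}]$. Let $c_{\mathsf e}\in C[0,\ell_{\mathsf e}]$ be real with $c_{\mathsf e}\ge c_0$ a.e. for some constant $c_0>0$ and all $\mathsf e$, and let $0\le p_{\mathsf e}\in L^\infty(0,\ell_{\mathsf e})$. Let $\mathcal H=\prod_{\mathsf e}L^2(0,\ell_{\mathsf e})$ (real, with its Hilbert space norm), and $$A_{\max}u=\big((c_{\mathsf e}u_{\mathsf e}')'-p_{\mathsf e}u_{\mathsf e}\big)_{\mathsf e},\qquad D(A_{\max})=\{u\in\mathcal H:\ u_{\mathsf e}\in H^1(0,\ell_{\mathsf e}),\ c_{\mathsf e}u_{\mathsf e}'\in H^1(0,\ell_{\mathsf e})\ \text{for all }\mathsf e\},$$ so that $D(A_{\max})=\prod_{\mathsf e}H^2(0,\ell_{\mathsf e})$ if all $c_{\mathsf e}$ are Lipschitz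 continuous. For a vertex $\mathsf v$ with incident edges $\mathsf e_1,\dots,\mathsf e_{d_{\mathsf v}}$ (in any fixed order) and $u\in D(A_{\max})$, let $U(\mathsf v)\in\mathbb R^{d_{\mathsf v}}$ be the vector of the values $u_{\mathsf e_i}(\mathsf v)$ and $U'(\mathsf v)\in\mathbb R^{d_{\mathsf v}}$ the vector of the derivatives $u_{\mathsf e_i}'(\mathsf v)$ taken in the direction away from $\mathsf v$; let $I_{\mathsf v}\in\mathbb R^{(d_{\mathsf v}-1)\times d_{\mathsf v}}$ be the bidiagonal matrix with rows $(0,\dots,0,1,-1,0,\dots,0)$, and $C(\mathsf v)^\top=(c_{\mathsf e_1}(\mathsf v),\dots,c_{\mathsf e_{d_{\mathsf v}}}(\mathsf v))$. Define $$B\colon D(A_{\max})\to\mathbb R^{2m},\qquad Bu=\begin{pmatrix}(I_{\mathsf v}U(\mathsf v))_{\mathsf v\in\mathsf V}\\(C(\mathsf v)^\top U'(\mathsf v))_{\mathsf v\in\mathsf V}\end{pmatrix},$$ and let $A$ be the restriction of $A_{\max}$ to $D(A)=\operatorname{Ker}B$. Further let $A_{K,\max}$ be the restriction of $A_{\max}$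 to $\{u\in D(A_{\max}): I_{\mathsf v}U(\mathsf v)=0\ \text{for all }\mathsf v\}$, let $B_K\colon D(A_{K,\max})\to\mathbb R^n$, $B_Ku=(C(\mathsf v)^\top U'(\mathsf v))_{\mathsf v}$, and let $A_K$ be the restriction of $A_{K,\max}$ to $\operatorname{Ker}B_K$. For an operator $T$ in $\mathcal H$ let $\rho(T)$ be the set of all real $\lambda$ such that $\lambda-T\colon D(T)\to\mathcal H$ is bijective with bounded inverse. Then the following hold. 1. $A$ generates a $C_0$-semigroup on $\mathcal H$. For every $\lambda\in\rho(A)$ the restriction $B|_{\operatorname{Ker}(\lambda-A_{\max})}\colon\operatorname{Ker}(\lambda-A_{\max})\to\mathbb R^{2m}$ is bijective, and its inverse is a bounded operator $D_{B,\lambda}\colon\mathbb R^{2m}\to\mathcal H$. 2. $A_K=A$, and this operator generates a $C_0$-semigroup on $\mathcal H$. For every $\lambda>0$, and more generally for every $\lambda\in\rho(A_K)$, the restriction $B_K|_{\operatorname{Ker}(\lambda-A_{K,\max})}\colon\operatorname{Ker}(\lambda-A_{K,\max})\to\mathbb R^{n}$ is bijective, and its inverse is a bounded operator $D_{B_K,\lambda}\colon\mathbb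 R^{n}\to\mathcal H$. -/

import Mathlib

open MeasureTheory Set Filter Topology
open scoped ENNReal NNReal ContDiff

noncomputable section

namespace QG

/-- The real Hilbert space `L²(0, ℓ)`. -/
abbrev L2 (ℓ : ℝ) : Type := Lp ℝ 2 (volume.restrict (Ioo (0 : ℝ) ℓ))

/-- `g` is the weak derivative of `f` on `(0, ℓ)`, both in `L²(0, ℓ)`. -/
def HasWeakDeriv {ℓ : ℝ} (f g : L2 ℓ) : Prop :=
  ∀ φ : ℝ → ℝ, ContDiff ℝ ∞ φ → HasCompactSupport φ → tsupport φ ⊆ Ioo 0 ℓ →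
    ∫ x in Ioo 0 ℓ, f x * deriv φ x = -∫ x in Ioo 0 ℓ, g x * φ x

theorem L2.integrable {ℓ : ℝ} (f : L2 ℓ) : IntegrableOn f (Ioo 0 ℓ) volume :=
  (Lp.memLp f).integrable (by norm_num)

theorem L2.intervalIntegrable {ℓ : ℝ} (hℓ : 0 ≤ ℓ) (f : L2 ℓ) :
    IntervalIntegrable f volume 0 ℓ := by
  rw [intervalIntegrable_iff_integrableOn_Ioo_of_le hℓ]
  exact L2.integrable f

theorem integrable_mul_test {ℓ : ℝ} {f φ : ℝ → ℝ} (hf : IntegrableOn f (Ioo 0 ℓ) volume)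
    (hφ : Continuous φ) (hc : HasCompactSupport φ) :
    IntegrableOn (fun x => f x * φ x) (Ioo 0 ℓ) volume := by
  obtain ⟨C, hC⟩ := hc.exists_bound_of_continuous hφ
  exact Integrable.mul_bdd hf hφ.aestronglyMeasurable (ae_of_all _ hC)

theorem setIntegral_test {ℓ : ℝ} {f φ : ℝ → ℝ} (h : tsupport φ ⊆ Ioo 0 ℓ) :
    ∫ x in Ioo 0 ℓ, f x * φ x = ∫ x, φ x * f x := by
  rw [← setIntegral_eq_integral_of_forall_compl_eq_zero (s := Ioo 0 ℓ) (f := fun x => φ x * f x)]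
  · simp only [mul_comm]
  · intro x hx
    have : φ x = 0 := image_eq_zero_of_notMem_tsupport (fun h' => hx (h h'))
    simp [this]

/-- An integrable function on `(0, ℓ)` that annihilates all test functions vanishes a.e. -/
theorem ae_zero_of_test {ℓ : ℝ} {f : ℝ → ℝ} (hf : IntegrableOn f (Ioo 0 ℓ) volume)
    (h : ∀ φ : ℝ → ℝ, ContDiff ℝ ∞ φ → HasCompactSupport φ → tsupport φ ⊆ Ioo 0 ℓ →
      ∫ x in Ioo 0 ℓ, f x * φ x = 0) :
    ∀ᵐ x ∂(volume.restrict (Ioo 0 ℓ)), f x = 0 := by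
  rw [ae_restrict_iff' measurableSet_Ioo]
  refine isOpen_Ioo.ae_eq_zero_of_integral_contDiff_smul_eq_zero hf.locallyIntegrableOn ?_
  intro φ h1 h2 h3
  have := h φ h1 h2 h3
  rw [setIntegral_test h3] at this
  simpa using this

theorem HasWeakDeriv.unique {ℓ : ℝ} {f g₁ g₂ : L2 ℓ} (h₁ : HasWeakDeriv f g₁)
    (h₂ : HasWeakDeriv f g₂) : g₁ = g₂ := by
  apply Lp.ext
  have : ∀ᵐ x ∂(volume.restrict (Ioo 0 ℓ)), g₁ x - g₂ x = 0 := by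
    apply ae_zero_of_test (g₁.integrable.sub (L2.integrable g₂))
    intro φ a b c
    have e := (h₁ φ a b c).symm.trans (h₂ φ a b c)
    change ∫ x in Ioo 0 ℓ, (g₁ x - g₂ x) * φ x = 0
    simp only [sub_mul]
    rw [integral_sub (integrable_mul_test (L2.integrable g₁) a.continuous b)
      (integrable_mul_test (L2.integrable g₂) a.continuous b)]
    linarith
  filter_upwards [this] with x hx
  linarith

theorem HasWeakDeriv.add {ℓ : ℝ} {f₁ f₂ g₁ g₂ : L2 ℓ} (h₁ : HasWeakDeriv f₁ g₁)
    (h₂ : HasWeakDeriv f₂ g₂) : HasWeakDeriv (f₁ + f₂) (g₁ + g₂) := by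
  intro φ a b c
  have d : Continuous (deriv φ) := a.continuous_deriv (by simp)
  have e1 : ∫ x in Ioo 0 ℓ, (f₁ + f₂ : L2 ℓ) x * deriv φ x
      = ∫ x in Ioo 0 ℓ, (f₁ x * deriv φ x + f₂ x * deriv φ x) := by
    apply integral_congr_ae
    filter_upwards [Lp.coeFn_add f₁ f₂] with x hx
    rw [hx, Pi.add_apply, add_mul]
  have e2 : ∫ x in Ioo 0 ℓ, (g₁ + g₂ : L2 ℓ) x * φ x
      = ∫ x in Ioo 0 ℓ, (g₁ x * φ x + g₂ x * φ x) := by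
    apply integral_congr_ae
    filter_upwards [Lp.coeFn_add g₁ g₂] with x hx
    rw [hx, Pi.add_apply, add_mul]
  rw [e1, e2, integral_add (integrable_mul_test (L2.integrable f₁) d b.deriv)
    (integrable_mul_test (L2.integrable f₂) d b.deriv),
    integral_add (integrable_mul_test (L2.integrable g₁) a.continuous b)
    (integrable_mul_test (L2.integrable g₂) a.continuous b), h₁ φ a b c, h₂ φ a b c]
  ring

theorem HasWeakDeriv.smul {ℓ : ℝ} {f g : L2 ℓ} (r : ℝ) (h : HasWeakDeriv f g) :
    HasWeakDeriv (r • f) (r • g) := by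
  intro φ a b c
  have e1 : ∫ x in Ioo 0 ℓ, (r • f : L2 ℓ) x * deriv φ x
      = ∫ x in Ioo 0 ℓ, r * (f x * deriv φ x) := by
    apply integral_congr_ae
    filter_upwards [Lp.coeFn_smul r f] with x hx
    rw [hx, Pi.smul_apply, smul_eq_mul, mul_assoc]
  have e2 : ∫ x in Ioo 0 ℓ, (r • g : L2 ℓ) x * φ x
      = ∫ x in Ioo 0 ℓ, r * (g x * φ x) := by
    apply integral_congr_ae
    filter_upwards [Lp.coeFn_smul r g] with x hx
    rw [hx, Pi.smul_apply, smul_eq_mul, mul_assoc]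
  rw [e1, e2, integral_const_mul, integral_const_mul, h φ a b c]
  ring

theorem HasWeakDeriv.zero {ℓ : ℝ} : HasWeakDeriv (0 : L2 ℓ) 0 := by
  intro φ a b c
  have e (ψ : ℝ → ℝ) : ∫ x in Ioo 0 ℓ, (0 : L2 ℓ) x * ψ x = 0 := by
    apply integral_eq_zero_of_ae
    filter_upwards [Lp.coeFn_zero ℝ 2 (volume.restrict (Ioo 0 ℓ))] with x hx
    rw [hx]; simp
  rw [e, e, neg_zero]

/-- Integration by parts for a primitive against a test function. -/
theorem integral_primitive_mul_deriv {ℓ : ℝ} (hℓ : 0 < ℓ) (a : ℝ) (g : L2 ℓ) {φ : ℝ → ℝ}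
    (h1 : ContDiff ℝ ∞ φ) (h3 : tsupport φ ⊆ Ioo 0 ℓ) :
    ∫ x in Ioo 0 ℓ, (a + ∫ t in (0 : ℝ)..x, g t) * deriv φ x = -∫ x in Ioo 0 ℓ, g x * φ x := by
  have hg := L2.intervalIntegrable hℓ.le g
  set F : ℝ → ℝ := fun x => a + ∫ t in (0 : ℝ)..x, g t with hF
  have hFac : AbsolutelyContinuousOnInterval F 0 ℓ := by
    have c : AbsolutelyContinuousOnInterval (fun _ : ℝ => a) 0 ℓ :=
      (LipschitzWith.const a).lipschitzOnWith.absolutelyContinuousOnInterval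
    exact c.add (hg.absolutelyContinuousOnInterval_intervalIntegral (by simp))
  have hφac : AbsolutelyContinuousOnInterval φ 0 ℓ :=
    ((h1.of_le (by simp)).contDiffOn).absolutelyContinuousOnInterval
  have z (x : ℝ) (hx : x ∉ Ioo 0 ℓ) : φ x = 0 :=
    image_eq_zero_of_notMem_tsupport (fun h' => hx (h3 h'))
  have key := hFac.integral_mul_deriv_eq_deriv_mul hφac
  rw [z 0 (by simp), z ℓ (by simp), mul_zero, mul_zero, sub_zero, zero_sub] at key
  rw [← integral_Ioc_eq_integral_Ioo, ← integral_Ioc_eq_integral_Ioo,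
    ← intervalIntegral.integral_of_le hℓ.le, ← intervalIntegral.integral_of_le hℓ.le, key]
  congr 1
  apply intervalIntegral.integral_congr_ae
  filter_upwards [hg.ae_hasDerivAt_integral] with x hx hx'
  have := (hx (uIoc_subset_uIcc hx') 0 (by simp)).const_add a
  rw [this.deriv]

/-- A function with vanishing weak derivative is constant. -/
theorem ae_const_of_test {ℓ : ℝ} (hℓ : 0 < ℓ) {f : ℝ → ℝ}
    (hf : IntegrableOn f (Ioo 0 ℓ) volume)
    (h : ∀ φ : ℝ → ℝ, ContDiff ℝ ∞ φ → HasCompactSupport φ → tsupport φ ⊆ Ioo 0 ℓ →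
      ∫ x in Ioo 0 ℓ, f x * deriv φ x = 0) :
    ∃ k : ℝ, ∀ᵐ x ∂(volume.restrict (Ioo 0 ℓ)), f x = k := by
  -- a bump function of integral one
  let b : ContDiffBump (ℓ / 2) := ⟨ℓ / 8, ℓ / 4, by positivity, by linarith⟩
  set ψ₀ : ℝ → ℝ := b.normed volume with hψ₀
  have p1 : ContDiff ℝ ∞ ψ₀ := b.contDiff_normed
  have p2 : HasCompactSupport ψ₀ := b.hasCompactSupport_normed
  have p3 : tsupport ψ₀ ⊆ Icc (ℓ / 4) (3 * ℓ / 4) := by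
    rw [hψ₀, b.tsupport_normed_eq, Real.closedBall_eq_Icc]
    apply Icc_subset_Icc <;> simp only [b] <;> linarith
  have p3' : tsupport ψ₀ ⊆ Ioo 0 ℓ := p3.trans (Icc_subset_Ioo (by linarith) (by linarith))
  have p4 : ∫ x, ψ₀ x = 1 := b.integral_normed
  refine ⟨∫ x in Ioo 0 ℓ, f x * ψ₀ x, ?_⟩
  set k := ∫ x in Ioo 0 ℓ, f x * ψ₀ x with hk
  suffices ∀ᵐ x ∂(volume.restrict (Ioo 0 ℓ)), f x - k = 0 by
    filter_upwards [this] with x hx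
    linarith
  have hkint : IntegrableOn (fun _ : ℝ => k) (Ioo 0 ℓ) volume := integrableOn_const (by simp)
  apply ae_zero_of_test (hf.sub hkint)
  intro ψ q1 q2 q3
  set s := ∫ x, ψ x with hs
  set η : ℝ → ℝ := fun x => ψ x - s * ψ₀ x with hη
  have hηc : Continuous η := q1.continuous.sub (continuous_const.mul p1.continuous)
  have hηd : ContDiff ℝ ∞ η := q1.sub (contDiff_const.mul p1)
  have hηs : HasCompactSupport η := q2.sub (p2.mul_left)
  have hη3 : tsupport η ⊆ Ioo 0 ℓ := by
    refine (tsupport_sub _ _).trans (union_subset q3 ?_)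
    exact (tsupport_mul_subset_right).trans p3'
  -- `η` is supported in a compact subinterval
  obtain ⟨α, β, hα, hαβ, hβ, hsub⟩ : ∃ α β : ℝ, 0 < α ∧ α ≤ β ∧ β < ℓ ∧ tsupport η ⊆ Icc α β := by
    rcases (tsupport η).eq_empty_or_nonempty with he | hne
    · exact ⟨ℓ / 2, ℓ / 2, by linarith, le_rfl, by linarith, by simp [he]⟩
    · have hcpt : IsCompact (tsupport η) := hηs
      have m1 := hcpt.sInf_mem hne
      have m2 := hcpt.sSup_mem hne
      refine ⟨sInf (tsupport η), sSup (tsupport η), (hη3 m1).1, ?_, (hη3 m2).2, ?_⟩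
      · exact csInf_le hcpt.bddBelow m2
      · intro x hx
        exact ⟨csInf_le hcpt.bddBelow hx, le_csSup hcpt.bddAbove hx⟩
  have hz (x : ℝ) (hx : x ∉ Icc α β) : η x = 0 :=
    image_eq_zero_of_notMem_tsupport (fun h' => hx (hsub h'))
  set Φ : ℝ → ℝ := fun x => ∫ t in (0 : ℝ)..x, η t with hΦ
  have hder (x : ℝ) : HasDerivAt Φ (η x) x :=
    intervalIntegral.integral_hasDerivAt_right (hηc.intervalIntegrable _ _)
      (hηc.stronglyMeasurableAtFilter _ _) hηc.continuousAt
  have hderiv : deriv Φ = η := funext fun x => (hder x).deriv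
  have hΦd : ContDiff ℝ ∞ Φ := by
    rw [contDiff_infty_iff_deriv, hderiv]
    exact ⟨fun x => (hder x).differentiableAt, hηd⟩
  have hint : ∫ x, η x = 0 := by
    rw [hη, integral_sub (q1.continuous.integrable_of_hasCompactSupport q2)
      ((p1.continuous.integrable_of_hasCompactSupport p2).const_mul s), integral_const_mul, p4]
    simp [hs]
  have hΦz (x : ℝ) (hx : x ∉ Icc α β) : Φ x = 0 := by
    rw [mem_Icc, not_and_or, not_le, not_le] at hx
    rcases hx with hx | hx
    · have : ∫ t in (0 : ℝ)..x, η t = ∫ t in (0 : ℝ)..x, (0 : ℝ) := by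
        apply intervalIntegral.integral_congr
        intro t ht
        apply hz
        rintro ⟨ht1, _⟩
        have := ht.2
        have : max 0 x < α := max_lt hα hx
        exact absurd (ht1.trans ht.2) (by simpa using this)
      simpa [hΦ] using this
    · have h0x : (0 : ℝ) ≤ x := by linarith
      have : ∫ t in Ioc 0 x, η t = ∫ t, η t := by
        apply setIntegral_eq_integral_of_forall_compl_eq_zero
        intro t ht
        apply hz
        rintro ⟨ht1, ht2⟩
        exact ht ⟨by linarith, by linarith⟩
      simp only [hΦ]
      rw [intervalIntegral.integral_of_le h0x, this, hint]
  have hΦts : tsupport Φ ⊆ Icc α β := by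
    apply closure_minimal _ isClosed_Icc
    intro x hx
    by_contra hc
    exact hx (hΦz x hc)
  have hΦc : HasCompactSupport Φ := HasCompactSupport.of_support_subset_isCompact isCompact_Icc
    ((subset_tsupport _).trans hΦts)
  have fin := h Φ hΦd hΦc (hΦts.trans (Icc_subset_Ioo hα hβ))
  rw [hderiv] at fin
  have e1 : ∫ x in Ioo 0 ℓ, f x * η x
      = (∫ x in Ioo 0 ℓ, f x * ψ x) - s * k := by
    rw [hk, ← integral_const_mul, ← integral_sub (integrable_mul_test hf q1.continuous q2)
      ((integrable_mul_test hf p1.continuous p2).const_mul s)]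
    congr 1
    ext x
    simp only [hη]
    ring
  have e2 : ∫ x in Ioo 0 ℓ, k * ψ x = s * k := by
    rw [setIntegral_test q3, integral_mul_const]
  change ∫ x in Ioo 0 ℓ, (f x - k) * ψ x = 0
  simp only [sub_mul]
  rw [integral_sub (integrable_mul_test hf q1.continuous q2)
    (integrable_mul_test hkint q1.continuous q2), e2]
  linarith

/-- Weak differentiability in terms of primitives. -/
theorem hasWeakDeriv_iff {ℓ : ℝ} (hℓ : 0 < ℓ) {f g : L2 ℓ} :
    HasWeakDeriv f g ↔
      ∃ a : ℝ, ∀ᵐ x ∂(volume.restrict (Ioo 0 ℓ)), f x = a + ∫ t in (0 : ℝ)..x, g t := by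
  constructor
  · intro h
    have hg := L2.intervalIntegrable hℓ.le g
    have hc : ContinuousOn (fun x => ∫ t in (0 : ℝ)..x, g t) (Icc 0 ℓ) := by
      have := (hg.absolutelyContinuousOnInterval_intervalIntegral (c := 0)
        (by simp)).continuousOn
      rwa [uIcc_of_le hℓ.le] at this
    have hci : IntegrableOn (fun x => ∫ t in (0 : ℝ)..x, g t) (Ioo 0 ℓ) volume :=
      (hc.integrableOn_Icc).mono_set Ioo_subset_Icc_self
    obtain ⟨k, hk⟩ := ae_const_of_test hℓ (f := fun x => f x - ∫ t in (0 : ℝ)..x, g t)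
      (f.integrable.sub hci) (by
        intro φ a b c
        have d : Continuous (deriv φ) := a.continuous_deriv (by simp)
        have := integral_primitive_mul_deriv hℓ 0 g a c
        simp only [zero_add] at this
        simp only [sub_mul]
        rw [integral_sub (integrable_mul_test (L2.integrable f) d b.deriv)
          (integrable_mul_test hci d b.deriv), h φ a b c, this, sub_self])
    refine ⟨k, ?_⟩
    filter_upwards [hk] with x hx
    linarith
  · rintro ⟨a, ha⟩ φ h1 h2 h3
    rw [← integral_primitive_mul_deriv hℓ a g h1 h3]
    apply integral_congr_ae
    filter_upwards [ha] with x hx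
    rw [hx]


theorem ae_Ioc_of_ae_Ioo {ℓ : ℝ} {P : ℝ → Prop}
    (h : ∀ᵐ x ∂(volume.restrict (Ioo 0 ℓ)), P x) : ∀ᵐ x, x ∈ Ioc 0 ℓ → P x := by
  rw [Measure.restrict_congr_set Ioo_ae_eq_Ioc] at h
  exact (ae_restrict_iff' measurableSet_Ioc).1 h

/-- The Sobolev space `H¹(0, ℓ)`. -/
def H1 (ℓ : ℝ) : Submodule ℝ (L2 ℓ) where
  carrier := {f | ∃ g : L2 ℓ, HasWeakDeriv f g}
  add_mem' := fun ⟨g₁, h₁⟩ ⟨g₂, h₂⟩ => ⟨g₁ + g₂, h₁.add h₂⟩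
  zero_mem' := ⟨0, HasWeakDeriv.zero⟩
  smul_mem' := fun r _ ⟨g, h⟩ => ⟨r • g, h.smul r⟩

/-- The weak derivative `H¹(0, ℓ) → L²(0, ℓ)`. -/
def weakDeriv (ℓ : ℝ) : H1 ℓ →ₗ[ℝ] L2 ℓ where
  toFun f := f.2.choose
  map_add' f g := (f + g).2.choose_spec.unique (f.2.choose_spec.add g.2.choose_spec)
  map_smul' r f := (r • f).2.choose_spec.unique (f.2.choose_spec.smul r)

theorem hasWeakDeriv_weakDeriv {ℓ : ℝ} (f : H1 ℓ) : HasWeakDeriv (f : L2 ℓ) (weakDeriv ℓ f) :=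
  f.2.choose_spec

/-- The Sobolev space `H²(0, ℓ)`. -/
def H2 (ℓ : ℝ) : Submodule ℝ (L2 ℓ) := ((H1 ℓ).comap (weakDeriv ℓ)).map (H1 ℓ).subtype

theorem continuousOn_primitive {ℓ : ℝ} (hℓ : 0 < ℓ) (g : L2 ℓ) :
    ContinuousOn (fun x => ∫ t in (0 : ℝ)..x, g t) (Icc 0 ℓ) := by
  have := ((L2.intervalIntegrable hℓ.le g).absolutelyContinuousOnInterval_intervalIntegral (c := 0)
    (by simp)).continuousOn
  rwa [uIcc_of_le hℓ.le] at this

theorem IccExtend_eqOn {ℓ : ℝ} (hℓ : 0 < ℓ) (F : C(Icc (0 : ℝ) ℓ, ℝ)) {x : ℝ}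
    (hx : x ∈ Icc 0 ℓ) : IccExtend hℓ.le F x = F ⟨x, hx⟩ :=
  IccExtend_of_mem _ _ hx

theorem exists_contRep {ℓ : ℝ} (hℓ : 0 < ℓ) (f : H1 ℓ) : ∃ F : C(Icc (0 : ℝ) ℓ, ℝ),
    ((f : L2 ℓ) : ℝ → ℝ) =ᵐ[volume.restrict (Ioo 0 ℓ)] IccExtend hℓ.le F := by
  obtain ⟨a, ha⟩ := (hasWeakDeriv_iff hℓ).1 (hasWeakDeriv_weakDeriv f)
  have hc : ContinuousOn (fun x => a + ∫ t in (0 : ℝ)..x, weakDeriv ℓ f t) (Icc 0 ℓ) :=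
    continuousOn_const.add (continuousOn_primitive hℓ _)
  refine ⟨⟨_, continuousOn_iff_continuous_domRestrict.1 hc⟩, ?_⟩
  filter_upwards [ha, ae_restrict_mem measurableSet_Ioo] with x hx hx'
  rw [IccExtend_eqOn hℓ _ (Ioo_subset_Icc_self hx'), hx]
  rfl

theorem contRep_unique {ℓ : ℝ} (hℓ : 0 < ℓ) {F G : C(Icc (0 : ℝ) ℓ, ℝ)}
    (h : IccExtend hℓ.le F =ᵐ[volume.restrict (Ioo 0 ℓ)] IccExtend hℓ.le G) : F = G := by
  rw [Measure.restrict_congr_set Ioo_ae_eq_Icc] at h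
  have := Measure.eqOn_Icc_of_ae_eq volume hℓ.ne h
    (F.continuous.Icc_extend').continuousOn (G.continuous.Icc_extend').continuousOn
  ext x
  have e := this x.2
  rwa [IccExtend_eqOn hℓ _ x.2, IccExtend_eqOn hℓ _ x.2] at e

/-- The continuous representative on `[0, ℓ]` of a function in `H¹(0, ℓ)`. -/
def contRep {ℓ : ℝ} (hℓ : 0 < ℓ) : H1 ℓ →ₗ[ℝ] C(Icc (0 : ℝ) ℓ, ℝ) where
  toFun f := (exists_contRep hℓ f).choose
  map_add' f g := by
    apply contRep_unique hℓ
    have h1 := (exists_contRep hℓ f).choose_spec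
    have h2 := (exists_contRep hℓ g).choose_spec
    have h3 := (exists_contRep hℓ (f + g)).choose_spec
    filter_upwards [h1, h2, h3, Lp.coeFn_add (f : L2 ℓ) (g : L2 ℓ)] with x e1 e2 e3 e4
    rw [← e3, Submodule.coe_add, e4, Pi.add_apply, e1, e2]
    rfl
  map_smul' r f := by
    apply contRep_unique hℓ
    have h1 := (exists_contRep hℓ f).choose_spec
    have h3 := (exists_contRep hℓ (r • f)).choose_spec
    filter_upwards [h1, h3, Lp.coeFn_smul r (f : L2 ℓ)] with x e1 e3 e4
    rw [← e3, Submodule.coe_smul, e4, Pi.smul_apply, e1]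
    rfl

theorem contRep_ae_eq {ℓ : ℝ} (hℓ : 0 < ℓ) (f : H1 ℓ) :
    ((f : L2 ℓ) : ℝ → ℝ) =ᵐ[volume.restrict (Ioo 0 ℓ)] IccExtend hℓ.le (contRep hℓ f) :=
  (exists_contRep hℓ f).choose_spec

theorem contRep_eq_primitive {ℓ : ℝ} (hℓ : 0 < ℓ) (f : H1 ℓ) : ∃ a : ℝ, ∀ x : Icc (0 : ℝ) ℓ,
    contRep hℓ f x = a + ∫ t in (0 : ℝ)..x, weakDeriv ℓ f t := by
  obtain ⟨a, ha⟩ := (hasWeakDeriv_iff hℓ).1 (hasWeakDeriv_weakDeriv f)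
  have hc : ContinuousOn (fun x => a + ∫ t in (0 : ℝ)..x, weakDeriv ℓ f t) (Icc 0 ℓ) :=
    continuousOn_const.add (continuousOn_primitive hℓ _)
  refine ⟨a, fun x => ?_⟩
  have : contRep hℓ f = ⟨_, continuousOn_iff_continuous_domRestrict.1 hc⟩ := by
    apply contRep_unique hℓ
    filter_upwards [ha, contRep_ae_eq hℓ f, ae_restrict_mem measurableSet_Ioo] with x h1 h2 h3
    rw [← h2, IccExtend_eqOn hℓ _ (Ioo_subset_Icc_self h3), h1]
    rfl
  rw [this]
  rfl

/-- Multiplication of an `L²` function by a fixed `L^∞` function. -/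
def mulBdd {ℓ : ℝ} (a : Lp ℝ ∞ (volume.restrict (Ioo (0 : ℝ) ℓ))) : L2 ℓ →ₗ[ℝ] L2 ℓ where
  toFun f := (a • f : Lp ℝ 2 (volume.restrict (Ioo (0 : ℝ) ℓ)))
  map_add' f g := Lp.add_smul a f g
  map_smul' r f := (Lp.smul_comm r a f).symm

theorem mulBdd_ae_eq {ℓ : ℝ} (a : Lp ℝ ∞ (volume.restrict (Ioo (0 : ℝ) ℓ))) (f : L2 ℓ) :
    ∀ᵐ x ∂(volume.restrict (Ioo 0 ℓ)), mulBdd a f x = a x * f x :=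
  Lp.coeFn_lpSMul a f

theorem memLp_IccExtend {ℓ : ℝ} (hℓ : 0 < ℓ) (c : C(Icc (0 : ℝ) ℓ, ℝ)) :
    MemLp (IccExtend hℓ.le c) ∞ (volume.restrict (Ioo (0 : ℝ) ℓ)) := by
  refine memLp_top_of_bound c.continuous.Icc_extend'.aestronglyMeasurable ‖c‖ (ae_of_all _ ?_)
  intro x
  exact c.norm_coe_le_norm _

/-- A continuous function on `[0, ℓ]` as an element of `L^∞(0, ℓ)`. -/
def contToLinf {ℓ : ℝ} (hℓ : 0 < ℓ) (c : C(Icc (0 : ℝ) ℓ, ℝ)) :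
    Lp ℝ ∞ (volume.restrict (Ioo (0 : ℝ) ℓ)) := (memLp_IccExtend hℓ c).toLp

theorem contToLinf_ae_eq {ℓ : ℝ} (hℓ : 0 < ℓ) (c : C(Icc (0 : ℝ) ℓ, ℝ)) :
    (contToLinf hℓ c : ℝ → ℝ) =ᵐ[volume.restrict (Ioo 0 ℓ)] IccExtend hℓ.le c :=
  (memLp_IccExtend hℓ c).coeFn_toLp

/-- The maximal domain in `L²(0, ℓ)` of `u ↦ (c u')'`:
all `u ∈ H¹(0, ℓ)` with `c u' ∈ H¹(0, ℓ)`. -/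
def edgeDomain {ℓ : ℝ} (hℓ : 0 < ℓ) (c : C(Icc (0 : ℝ) ℓ, ℝ)) : Submodule ℝ (L2 ℓ) :=
  ((H1 ℓ).comap (mulBdd (contToLinf hℓ c) ∘ₗ weakDeriv ℓ)).map (H1 ℓ).subtype

theorem mem_edgeDomain {ℓ : ℝ} {hℓ : 0 < ℓ} {c : C(Icc (0 : ℝ) ℓ, ℝ)} {f : L2 ℓ} :
    f ∈ edgeDomain hℓ c ↔
      ∃ hf : f ∈ H1 ℓ, mulBdd (contToLinf hℓ c) (weakDeriv ℓ ⟨f, hf⟩) ∈ H1 ℓ := by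
  constructor
  · rintro ⟨g, hg, rfl⟩
    exact ⟨g.2, hg⟩
  · rintro ⟨hf, h⟩
    exact ⟨⟨f, hf⟩, h, rfl⟩

theorem edgeDomain_le {ℓ : ℝ} (hℓ : 0 < ℓ) (c : C(Icc (0 : ℝ) ℓ, ℝ)) :
    edgeDomain hℓ c ≤ H1 ℓ := fun _ h => (mem_edgeDomain.1 h).1

/-- The flux `u ↦ c u'`, as a map from the maximal domain to `H¹(0, ℓ)`. -/
def edgeFlux {ℓ : ℝ} (hℓ : 0 < ℓ) (c : C(Icc (0 : ℝ) ℓ, ℝ)) : edgeDomain hℓ c →ₗ[ℝ] H1 ℓ :=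
  (mulBdd (contToLinf hℓ c) ∘ₗ weakDeriv ℓ ∘ₗ Submodule.inclusion (edgeDomain_le hℓ c)).codRestrict
    (H1 ℓ) fun f => (mem_edgeDomain.1 f.2).2

/-- The operator `u ↦ (c u')' - p u` on one edge. -/
def edgeOp {ℓ : ℝ} (hℓ : 0 < ℓ) (c : C(Icc (0 : ℝ) ℓ, ℝ))
    (p : Lp ℝ ∞ (volume.restrict (Ioo (0 : ℝ) ℓ))) : edgeDomain hℓ c →ₗ[ℝ] L2 ℓ :=
  weakDeriv ℓ ∘ₗ edgeFlux hℓ c - mulBdd p ∘ₗ (edgeDomain hℓ c).subtype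

/-- The value at `x ∈ [0, ℓ]` of `u`, for `u` in the maximal domain. -/
def edgeVal {ℓ : ℝ} (hℓ : 0 < ℓ) (c : C(Icc (0 : ℝ) ℓ, ℝ)) (x : Icc (0 : ℝ) ℓ) :
    edgeDomain hℓ c →ₗ[ℝ] ℝ where
  toFun u := contRep hℓ (Submodule.inclusion (edgeDomain_le hℓ c) u) x
  map_add' u v := by simp
  map_smul' r u := by simp

/-- The value at `x ∈ [0, ℓ]` of the derivative `u'`, for `u` in the maximal domain: since
`c u' ∈ H¹(0, ℓ)` and `c` is continuous and positive, `u'` has the continuous representative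
`(c u') / c` (this is the classical derivative, see `hasDerivWithinAt_edgeVal`). -/
def edgeDeriv {ℓ : ℝ} (hℓ : 0 < ℓ) (c : C(Icc (0 : ℝ) ℓ, ℝ)) (x : Icc (0 : ℝ) ℓ) :
    edgeDomain hℓ c →ₗ[ℝ] ℝ where
  toFun u := contRep hℓ (edgeFlux hℓ c u) x / c x
  map_add' u v := by simp [add_div]
  map_smul' r u := by simp [mul_div_assoc]

/-- `edgeDeriv` is the classical derivative (one-sided at the end points) of the continuous
representative. -/
theorem hasDerivWithinAt_edgeVal {ℓ : ℝ} (hℓ : 0 < ℓ) (c : C(Icc (0 : ℝ) ℓ, ℝ))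
    (hc : ∀ x, 0 < c x) (u : edgeDomain hℓ c) (x : Icc (0 : ℝ) ℓ) :
    HasDerivWithinAt (IccExtend hℓ.le fun y => edgeVal hℓ c y u) (edgeDeriv hℓ c x u)
      (Icc 0 ℓ) x := by
  set u₁ := Submodule.inclusion (edgeDomain_le hℓ c) u with hu₁
  obtain ⟨a, ha⟩ := contRep_eq_primitive hℓ u₁
  let q : C(Icc (0 : ℝ) ℓ, ℝ) := ⟨fun y => edgeDeriv hℓ c y u,
    (contRep hℓ (edgeFlux hℓ c u)).continuous.div c.continuous fun y => (hc y).ne'⟩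
  have hq : Continuous (IccExtend hℓ.le q) := q.continuous.Icc_extend'
  have hae : ∀ᵐ y ∂(volume.restrict (Ioo 0 ℓ)), weakDeriv ℓ u₁ y = IccExtend hℓ.le q y := by
    filter_upwards [contRep_ae_eq hℓ (edgeFlux hℓ c u), contToLinf_ae_eq hℓ c,
      mulBdd_ae_eq (contToLinf hℓ c) (weakDeriv ℓ u₁),
      ae_restrict_mem measurableSet_Ioo] with y h1 h2 h3 h4
    have h5 := Ioo_subset_Icc_self h4
    rw [IccExtend_eqOn hℓ _ h5] at h1 h2 ⊢
    change mulBdd (contToLinf hℓ c) (weakDeriv ℓ u₁) y = _ at h1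
    rw [h3, h2] at h1
    change _ = contRep hℓ (edgeFlux hℓ c u) ⟨y, h5⟩ / c ⟨y, h5⟩
    rw [← h1, mul_div_cancel_left₀ _ (hc _).ne']
  have hder : HasDerivAt (fun z => a + ∫ t in (0 : ℝ)..z, IccExtend hℓ.le q t)
      (IccExtend hℓ.le q x) x :=
    (intervalIntegral.integral_hasDerivAt_right (hq.intervalIntegrable _ _)
      (hq.stronglyMeasurableAtFilter _ _) hq.continuousAt).const_add a
  have e0 : IccExtend hℓ.le q x = edgeDeriv hℓ c x u := IccExtend_val _ _ _
  rw [e0] at hder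
  have hval : ∀ z ∈ Icc 0 ℓ, IccExtend hℓ.le (fun y => edgeVal hℓ c y u) z
      = a + ∫ t in (0 : ℝ)..z, IccExtend hℓ.le q t := by
    intro z hz
    rw [IccExtend_of_mem _ _ hz]
    change contRep hℓ u₁ ⟨z, hz⟩ = _
    rw [ha]
    congr 1
    apply intervalIntegral.integral_congr_ae
    filter_upwards [ae_Ioc_of_ae_Ioo hae] with t ht ht'
    rw [uIoc_of_le hz.1] at ht'
    exact ht ⟨ht'.1, ht'.2.trans hz.2⟩
  exact hder.hasDerivWithinAt.congr hval (hval _ x.2)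

theorem mulBdd_mem_H1 {ℓ : ℝ} (hℓ : 0 < ℓ) (b : C(Icc (0 : ℝ) ℓ, ℝ)) {K : ℝ≥0}
    (hb : LipschitzWith K b) (g : H1 ℓ) : mulBdd (contToLinf hℓ b) g ∈ H1 ℓ := by
  obtain ⟨a, ha⟩ := (hasWeakDeriv_iff hℓ).1 (hasWeakDeriv_weakDeriv g)
  set g' := weakDeriv ℓ g with hg'
  have hgi := L2.intervalIntegrable hℓ.le g'
  set G : ℝ → ℝ := fun x => a + ∫ t in (0 : ℝ)..x, g' t with hG
  have hGac : AbsolutelyContinuousOnInterval G 0 ℓ := by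
    have c : AbsolutelyContinuousOnInterval (fun _ : ℝ => a) 0 ℓ :=
      (LipschitzWith.const a).lipschitzOnWith.absolutelyContinuousOnInterval
    exact c.add (hgi.absolutelyContinuousOnInterval_intervalIntegral (by simp))
  set β : ℝ → ℝ := IccExtend hℓ.le b with hβ
  have hβl : LipschitzWith K β := by
    have := hb.comp (LipschitzWith.projIcc hℓ.le)
    rwa [mul_one] at this
  have hβac : AbsolutelyContinuousOnInterval β 0 ℓ :=
    hβl.lipschitzOnWith.absolutelyContinuousOnInterval
  have hPac := hβac.fun_mul hGac
  have hd : ∀ᵐ x ∂(volume.restrict (Ioo 0 ℓ)),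
      deriv (fun x => β x * G x) x = deriv β x * G x + β x * g' x := by
    rw [ae_restrict_iff' measurableSet_Ioo]
    filter_upwards [hβac.ae_differentiableAt, hgi.ae_hasDerivAt_integral] with x h1 h2 h3
    have h4 : x ∈ uIcc 0 ℓ := by
      rw [uIcc_of_le hℓ.le]
      exact Ioo_subset_Icc_self h3
    exact ((h1 h4).hasDerivAt.mul ((h2 h4 0 (by simp)).const_add a)).deriv
  have hL : MemLp (deriv fun x => β x * G x) 2 (volume.restrict (Ioo 0 ℓ)) := by
    rw [memLp_congr_ae hd]
    have hG2 : MemLp G 2 (volume.restrict (Ioo 0 ℓ)) :=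
      (memLp_congr_ae ha).1 (Lp.memLp (g : L2 ℓ))
    have hβ' : MemLp (deriv β) ∞ (volume.restrict (Ioo 0 ℓ)) :=
      memLp_top_of_bound (measurable_deriv β).aestronglyMeasurable K
        (ae_of_all _ fun x => norm_deriv_le_of_lipschitz hβl)
    exact (hG2.mul hβ').add ((Lp.memLp g').mul (memLp_IccExtend hℓ b))
  refine ⟨hL.toLp, (hasWeakDeriv_iff hℓ).2 ⟨β 0 * G 0, ?_⟩⟩
  filter_upwards [mulBdd_ae_eq (contToLinf hℓ b) g, contToLinf_ae_eq hℓ b, ha,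
    ae_restrict_mem measurableSet_Ioo] with x h1 h2 h3 h4
  rw [h1, h2, h3]
  have hx : x ∈ Icc 0 ℓ := Ioo_subset_Icc_self h4
  have hsub : uIcc 0 x ⊆ uIcc 0 ℓ := by
    rw [uIcc_of_le hx.1, uIcc_of_le hℓ.le]
    exact Icc_subset_Icc_right hx.2
  have e1 := (hPac.mono hsub).integral_deriv_eq_sub
  have e2 : ∫ t in (0 : ℝ)..x, (hL.toLp _ : ℝ → ℝ) t = ∫ t in (0 : ℝ)..x, deriv (fun x => β x * G x) t := by
    apply intervalIntegral.integral_congr_ae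
    filter_upwards [ae_Ioc_of_ae_Ioo hL.coeFn_toLp] with t ht ht'
    rw [uIoc_of_le hx.1] at ht'
    exact ht ⟨ht'.1, ht'.2.trans hx.2⟩
  rw [e2, e1]
  change β x * G x = _
  ring

/-- For a Lipschitz coefficient the maximal domain of `u ↦ (c u')'` is `H²(0, ℓ)`. -/
theorem edgeDomain_eq_H2 {ℓ : ℝ} (hℓ : 0 < ℓ) (c : C(Icc (0 : ℝ) ℓ, ℝ)) {K : ℝ≥0}
    (hK : LipschitzWith K c) (hc : ∀ x, 0 < c x) : edgeDomain hℓ c = H2 ℓ := by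
  obtain ⟨x₀, -, hx₀⟩ := isCompact_univ.exists_isMinOn
    (⟨⟨0, le_rfl, hℓ.le⟩, mem_univ _⟩ : (univ : Set (Icc (0 : ℝ) ℓ)).Nonempty)
    c.continuous.continuousOn
  let ci : C(Icc (0 : ℝ) ℓ, ℝ) := ⟨fun x => (c x)⁻¹, c.continuous.inv₀ fun x => (hc x).ne'⟩
  set m := c x₀ with hm
  have hm0 : 0 < m := hc x₀
  have hmin (x) : m ≤ c x := hx₀ (mem_univ x)
  have hci : LipschitzWith (K * (Real.toNNReal (m * m)⁻¹)) ci := by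
    apply LipschitzWith.of_dist_le_mul
    intro x y
    have h1 := hK.dist_le_mul x y
    change |(c x)⁻¹ - (c y)⁻¹| ≤ _
    rw [inv_sub_inv (hc x).ne' (hc y).ne', abs_div, abs_of_pos (mul_pos (hc x) (hc y)),
      NNReal.coe_mul, Real.coe_toNNReal _ (by positivity), abs_sub_comm]
    rw [Real.dist_eq] at h1
    calc |c x - c y| / (c x * c y) ≤ (K * dist x y) / (m * m) := by
          have hmm : m * m ≤ c x * c y := mul_le_mul (hmin x) (hmin y) hm0.le (hc x).le
          gcongr
      _ = _ := by rw [div_eq_mul_inv]; ring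
  ext f
  constructor
  · intro h
    obtain ⟨hf, hw⟩ := mem_edgeDomain.1 h
    refine ⟨⟨f, hf⟩, ?_, rfl⟩
    have := mulBdd_mem_H1 hℓ ci hci ⟨_, hw⟩
    have e : mulBdd (contToLinf hℓ ci) (mulBdd (contToLinf hℓ c) (weakDeriv ℓ ⟨f, hf⟩))
        = weakDeriv ℓ ⟨f, hf⟩ := by
      apply Lp.ext
      filter_upwards [mulBdd_ae_eq (contToLinf hℓ ci)
        (mulBdd (contToLinf hℓ c) (weakDeriv ℓ ⟨f, hf⟩)),
        mulBdd_ae_eq (contToLinf hℓ c) (weakDeriv ℓ ⟨f, hf⟩), contToLinf_ae_eq hℓ ci,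
        contToLinf_ae_eq hℓ c, ae_restrict_mem measurableSet_Ioo] with x h1 h2 h3 h4 h5
      have h6 := Ioo_subset_Icc_self h5
      rw [IccExtend_eqOn hℓ _ h6] at h3 h4
      rw [h1, h2, h3, h4]
      exact inv_mul_cancel_left₀ (hc _).ne' _
    change mulBdd (contToLinf hℓ ci) (mulBdd (contToLinf hℓ c) (weakDeriv ℓ ⟨f, hf⟩)) ∈ H1 ℓ at this
    rwa [e] at this
  · rintro ⟨g, hg, rfl⟩
    exact mem_edgeDomain.2 ⟨g.2, mulBdd_mem_H1 hℓ c hK ⟨_, hg⟩⟩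

/-- A finite simple metric graph with the coefficients of the operator `u ↦ (c u')' - p u`.
Each edge `e` is parametrized by `[0, length e]` from `src e` to `tgt e`, and at each vertex
the incident edges are enumerated. Parametrizations and enumerations are arbitrary. -/
structure QuantumGraph (V : Type*) [Fintype V] [DecidableEq V] where
  graph : SimpleGraph V
  decAdj : DecidableRel graph.Adj
  src : graph.edgeSet → V
  tgt : graph.edgeSet → V
  ends : ∀ e, s(src e, tgt e) = (e : Sym2 V)
  length : graph.edgeSet → ℝ
  length_pos : ∀ e, 0 < length e
  cond : ∀ e, C(Icc (0 : ℝ) (length e), ℝ)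
  cond_bound : ∃ c₀ > 0, ∀ e, ∀ᵐ x ∂(volume.restrict (Ioo 0 (length e))),
    c₀ ≤ IccExtend (length_pos e).le (cond e) x
  pot : ∀ e, Lp ℝ ∞ (volume.restrict (Ioo (0 : ℝ) (length e)))
  pot_nonneg : ∀ e, ∀ᵐ x ∂(volume.restrict (Ioo 0 (length e))), 0 ≤ pot e x
  enum : ∀ v, Fin (graph.degree v) ≃ {e : graph.edgeSet // v ∈ (e : Sym2 V)}

attribute [instance] QuantumGraph.decAdj

namespace QuantumGraph

variable {V : Type*} [Fintype V] [DecidableEq V] (Γ : QuantumGraph V)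

theorem cond_pos (e : Γ.graph.edgeSet) (x : Icc (0 : ℝ) (Γ.length e)) : 0 < Γ.cond e x := by
  obtain ⟨c₀, h0, h⟩ := Γ.cond_bound
  have hℓ := Γ.length_pos e
  let F : C(Icc (0 : ℝ) (Γ.length e), ℝ) := ⟨fun y => max c₀ (Γ.cond e y), by fun_prop⟩
  have : F = Γ.cond e := by
    apply contRep_unique hℓ
    filter_upwards [h e] with y hy
    exact max_eq_right hy
  rw [← this]
  exact lt_max_of_lt_left h0

/-- The state space: the Hilbert direct sum of the `L²` spaces of the edges. -/
abbrev H : Type _ := PiLp 2 fun e : Γ.graph.edgeSet => L2 (Γ.length e)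

/-- The boundary space `ℝ^{2m}`: at each vertex `v` there are `deg v - 1` coordinates for the
continuity conditions and one for the Kirchhoff condition. -/
abbrev Y : Type _ := EuclideanSpace ℝ ((Σ v : V, Fin (Γ.graph.degree v - 1)) ⊕ V)

/-- The boundary space `ℝ^n` of the Kirchhoff conditions. -/
abbrev YK (_Γ : QuantumGraph V) : Type _ := EuclideanSpace ℝ V

/-- The boundary space has dimension `2m` if there are no isolated vertices. -/
theorem finrank_Y (hdeg : ∀ v, 0 < Γ.graph.degree v) :
    Module.finrank ℝ Γ.Y = 2 * Fintype.card Γ.graph.edgeSet := by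
  rw [finrank_euclideanSpace, Fintype.card_sum, Fintype.card_sigma]
  have h := Γ.graph.sum_degrees_eq_twice_card_edges
  rw [SimpleGraph.edgeFinset_card] at h
  rw [← h, ← Finset.card_univ, Finset.card_eq_sum_ones, ← Finset.sum_add_distrib]
  refine Finset.sum_congr rfl fun v _ => ?_
  rw [Fintype.card_fin]
  exact Nat.sub_add_cancel (hdeg v)

/-- The maximal domain: all `u` with `u_e ∈ H¹` and `c_e u_e' ∈ H¹` on every edge `e`. -/
def maxDomain : Submodule ℝ Γ.H where
  carrier := {u | ∀ e, u e ∈ edgeDomain (Γ.length_pos e) (Γ.cond e)}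
  add_mem' := fun hu hv e => Submodule.add_mem _ (hu e) (hv e)
  zero_mem' := fun _ => Submodule.zero_mem _
  smul_mem' := fun r _ hu e => Submodule.smul_mem _ r (hu e)

/-- The component on the edge `e` of an element of the maximal domain. -/
def comp (e : Γ.graph.edgeSet) :
    Γ.maxDomain →ₗ[ℝ] edgeDomain (Γ.length_pos e) (Γ.cond e) where
  toFun u := ⟨(u : Γ.H) e, u.2 e⟩
  map_add' _ _ := rfl
  map_smul' _ _ := rfl

/-- `A_max`: the operator `u ↦ ((c_e u_e')' - p_e u_e)_e` on its maximal domain. -/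
def Amax : Γ.H →ₗ.[ℝ] Γ.H where
  domain := Γ.maxDomain
  toFun := (WithLp.linearEquiv 2 ℝ (∀ e, L2 (Γ.length e))).symm.toLinearMap ∘ₗ
    LinearMap.pi fun e => edgeOp (Γ.length_pos e) (Γ.cond e) (Γ.pot e) ∘ₗ Γ.comp e

/-- For Lipschitz coefficients, the domain of `A_max` is the product of the spaces `H²`. -/
theorem mem_Amax_domain_iff {K : ℝ≥0} (hK : ∀ e, LipschitzWith K (Γ.cond e)) (u : Γ.H) :
    u ∈ Γ.Amax.domain ↔ ∀ e, u e ∈ H2 (Γ.length e) :=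
  forall_congr' fun e => by
    rw [edgeDomain_eq_H2 (Γ.length_pos e) (Γ.cond e) (hK e) (Γ.cond_pos e)]

/-- The parameter in `[0, length e]` of the end point `v` of the edge `e`. -/
def endpoint (v : V) (e : Γ.graph.edgeSet) : Icc (0 : ℝ) (Γ.length e) :=
  if Γ.src e = v then ⟨0, le_rfl, (Γ.length_pos e).le⟩
  else ⟨Γ.length e, (Γ.length_pos e).le, le_rfl⟩

/-- The sign that turns the derivative in the direction of the parametrization into the
derivative in the direction away from the vertex `v`. -/
def outward (v : V) (e : Γ.graph.edgeSet) : ℝ := if Γ.src e = v then 1 else -1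

/-- The vector `U(v)` of the values of `u` in `v` along the edges incident to `v`. -/
def vertexVal (v : V) : Γ.Amax.domain →ₗ[ℝ] (Fin (Γ.graph.degree v) → ℝ) :=
  LinearMap.pi fun i =>
    edgeVal (Γ.length_pos (Γ.enum v i)) (Γ.cond (Γ.enum v i)) (Γ.endpoint v (Γ.enum v i)) ∘ₗ
      Γ.comp (Γ.enum v i)

/-- The vector `U'(v)` of the derivatives of `u` in `v` along the edges incident to `v`,
taken in the directions away from `v`. -/
def vertexDeriv (v : V) : Γ.Amax.domain →ₗ[ℝ] (Fin (Γ.graph.degree v) → ℝ) :=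
  LinearMap.pi fun i => Γ.outward v (Γ.enum v i) •
    (edgeDeriv (Γ.length_pos (Γ.enum v i)) (Γ.cond (Γ.enum v i)) (Γ.endpoint v (Γ.enum v i)) ∘ₗ
      Γ.comp (Γ.enum v i))

/-- The bi-diagonal matrix with entries `1, -1`. -/
def contMatrix (d : ℕ) : Matrix (Fin (d - 1)) (Fin d) ℝ :=
  Matrix.of fun i j => if j.val = i.val then 1 else if j.val = i.val + 1 then -1 else 0

/-- The row `C(v)ᵀ` of the values in `v` of the conductances of the incident edges. -/
def condRow (v : V) : Fin (Γ.graph.degree v) → ℝ := fun i =>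
  Γ.cond (Γ.enum v i) (Γ.endpoint v (Γ.enum v i))

/-- `u ↦ (I_v U(v))_v`. -/
def contOp : Γ.Amax.domain →ₗ[ℝ] ((Σ v : V, Fin (Γ.graph.degree v - 1)) → ℝ) :=
  LinearMap.pi fun i => LinearMap.proj i.2 ∘ₗ
    (contMatrix (Γ.graph.degree i.1)).mulVecLin ∘ₗ Γ.vertexVal i.1

/-- `u ↦ (C(v)ᵀ U'(v))_v`. -/
def kirchhoffOp : Γ.Amax.domain →ₗ[ℝ] (V → ℝ) where
  toFun u v := Γ.condRow v ⬝ᵥ Γ.vertexDeriv v u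
  map_add' u w := by
    ext v
    simp
  map_smul' r u := by
    ext v
    simp

/-- The boundary operator `B : D(A_max) → ℝ^{2m}`. -/
def B : Γ.Amax.domain →ₗ[ℝ] Γ.Y where
  toFun u := WithLp.toLp 2 (Sum.elim (Γ.contOp u) (Γ.kirchhoffOp u))
  map_add' u w := by
    ext i
    rcases i with i | i <;> simp
  map_smul' r u := by
    ext i
    rcases i with i | i <;> simp

/-- The operator `A`: the restriction of `A_max` to the kernel of `B`. -/
def A : Γ.H →ₗ.[ℝ] Γ.H :=
  Γ.Amax.domRestrict ((LinearMap.ker Γ.B).map Γ.Amax.domain.subtype)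

/-- `A_{K,max}`: the restriction of `A_max` to the functions that are continuous on the graph. -/
def AKmax : Γ.H →ₗ.[ℝ] Γ.H :=
  Γ.Amax.domRestrict ((LinearMap.ker Γ.contOp).map Γ.Amax.domain.subtype)

/-- The Kirchhoff boundary operator `B_K : D(A_{K,max}) → ℝ^n`. -/
def BK : Γ.AKmax.domain →ₗ[ℝ] Γ.YK :=
  (WithLp.linearEquiv 2 ℝ (V → ℝ)).symm.toLinearMap ∘ₗ Γ.kirchhoffOp ∘ₗ
    Submodule.inclusion inf_le_right

/-- The restriction of `A_{K,max}` to the kernel of `B_K`. -/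
def AK : Γ.H →ₗ.[ℝ] Γ.H :=
  Γ.AKmax.domRestrict ((LinearMap.ker Γ.BK).map Γ.AKmax.domain.subtype)

end QuantumGraph

section Operators

variable {X : Type*} [NormedAddCommGroup X] [NormedSpace ℝ X]

/-- A `C₀`-semigroup (strongly continuous semigroup) of bounded operators on `X`. -/
structure C0Semigroup (X : Type*) [NormedAddCommGroup X] [NormedSpace ℝ X] where
  S : ℝ≥0 → X →L[ℝ] X
  map_zero : S 0 = ContinuousLinearMap.id ℝ X
  map_add : ∀ s t, S (s + t) = (S s).comp (S t)
  continuous_orbit : ∀ x, Continuous fun t => S t x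

/-- `A` is the generator of the semigroup `T`: `x ∈ D(A)` and `A x = y` if and only if
`(S(t) x - x) / t → y` as `t → 0+`. -/
def C0Semigroup.IsGenerator (T : C0Semigroup X) (A : X →ₗ.[ℝ] X) : Prop :=
  ∀ x y : X, (x, y) ∈ A.graph ↔
    Tendsto (fun t : ℝ≥0 => (t : ℝ)⁻¹ • (T.S t x - x)) (𝓝[>] 0) (𝓝 y)

/-- `A` generates a `C₀`-semigroup. -/
def GeneratesC0Semigroup (A : X →ₗ.[ℝ] X) : Prop := ∃ T : C0Semigroup X, T.IsGenerator A

/-- The map `μ - A : D(A) → X`. -/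
def subOp (A : X →ₗ.[ℝ] X) (μ : ℝ) : A.domain →ₗ[ℝ] X := μ • A.domain.subtype - A.toFun

/-- The resolvent set: all `μ` such that `μ - A : D(A) → X` is bijective with bounded inverse. -/
def resolventSet (A : X →ₗ.[ℝ] X) : Set ℝ :=
  {μ | Function.Bijective (subOp A μ) ∧ ∃ R : X →L[ℝ] X, ∀ x, R (subOp A μ x) = x}

/-- `D` is a bounded two-sided inverse of the restriction of `B : D(M) → Y` to `Ker(μ - M)`. -/
def IsDirichletOperator {Y : Type*} [NormedAddCommGroup Y] [NormedSpace ℝ Y] (M : X →ₗ.[ℝ] X)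
    (B : M.domain →ₗ[ℝ] Y) (μ : ℝ) (D : Y →L[ℝ] X) : Prop :=
  Function.Bijective (B.domRestrict (LinearMap.ker (subOp M μ))) ∧
    ∀ u : LinearMap.ker (subOp M μ), D (B u) = ((u : M.domain) : X)

end Operators

end QG

end

noncomputable section

namespace QG

/-! Green's formula on an edge writes the inner product of (c u')' - p u with u as -∫ c u'² - ∫ p u²
plus boundary terms. Regrouped by vertices, the boundary terms are minus the sums, over the edges at
a vertex, of value times outgoing flux. Continuity makes the value a common factor and the Kirchhoff
condition makes the remaining flux sum vanish. Hence A is dissipative (`inner_Amax_nonpos`), and μ -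
A is injective for μ > 0.

Surjectivity comes from a dimension count. On every edge the equation μ u - (c u')' + p u = h can be
solved with arbitrary value and flux at the initial point (`exists_edge_solution`), so Ker(μ -
A_max) has dimension at least 2m. For μ > 0 dissipativity makes B injective on this kernel, so B
maps it bijectively onto ℝ^{2m} (`bijective_B_ker`). Subtracting the kernel element with the same
boundary data turns a solution of (μ - A_max) u = h into one in D(A). The Lumer–Phillips theorem,
proved here for real Hilbert spaces by Yosida approximation, then yields the semigroup.

For a general λ in the resolvent set only three facts matter: the boundary operator is onto its
target (already known from μ = 1), the target is finite-dimensional, and λ minus the restricted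
operator is bijective (`exists_isDirichletOperator`). The statement for A_K follows because imposing
continuity first and the Kirchhoff conditions afterwards leaves the same domain, and because B_K
inherits surjectivity from B. -/

theorem subOp_apply {X : Type*} [NormedAddCommGroup X] [NormedSpace ℝ X]
    (A : X →ₗ.[ℝ] X) (μ : ℝ) (x : A.domain) :
    subOp A μ x = μ • (x : X) - A x := rfl

section Semigroups

variable {X : Type*} [NormedAddCommGroup X] [InnerProductSpace ℝ X]

/-! ### Semigroups of bounded dissipative operators and their strong limits. -/

section BoundedDissipative

variable [CompleteSpace X]

theorem hasDerivAt_exp_smul_apply (B : X →L[ℝ] X) (x : X) (s : ℝ) :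
    HasDerivAt (fun s : ℝ => NormedSpace.exp (s • B) x) (NormedSpace.exp (s • B) (B x)) s := by
  have h := hasDerivAt_exp_smul_const (𝕂 := ℝ) B s
  simpa using h.clm_apply (hasDerivAt_const s x)

/-- A bounded dissipative operator generates a contraction semigroup. -/
theorem norm_exp_smul_apply_le {B : X →L[ℝ] X} (hB : ∀ x, inner ℝ (B x) x ≤ 0) {t : ℝ}
    (ht : 0 ≤ t) (x : X) : ‖NormedSpace.exp (t • B) x‖ ≤ ‖x‖ := by
  have hd (s : ℝ) : HasDerivAt (fun s : ℝ => ‖NormedSpace.exp (s • B) x‖ ^ 2)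
      (2 * inner ℝ (NormedSpace.exp (s • B) x) (NormedSpace.exp (s • B) (B x))) s :=
    (hasDerivAt_exp_smul_apply B x s).norm_sq
  -- With y = exp(sB) x, the derivative of ‖y‖² is 2⟨By, y⟩ ≤ 0, since B commutes with its
  -- exponential.
  have hanti : Antitone fun s : ℝ => ‖NormedSpace.exp (s • B) x‖ ^ 2 := by
    apply antitone_of_deriv_nonpos (fun s => (hd s).differentiableAt)
    intro s
    rw [(hd s).deriv, real_inner_comm]
    have hc : Commute (NormedSpace.exp (s • B)) B := ((Commute.refl B).smul_left s).exp_left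
    have e : NormedSpace.exp (s • B) (B x) = B (NormedSpace.exp (s • B) x) :=
      congrArg (fun T : X →L[ℝ] X => T x) hc.eq
    rw [e]
    linarith [hB (NormedSpace.exp (s • B) x)]
  have := hanti ht
  simp only [zero_smul, NormedSpace.exp_zero, one_apply_eq_self] at this
  exact (sq_le_sq₀ (norm_nonneg _) (norm_nonneg _)).1 this

theorem exp_add_smul (B : X →L[ℝ] X) (s t : ℝ) :
    NormedSpace.exp ((s + t) • B) = NormedSpace.exp (s • B) * NormedSpace.exp (t • B) := by
  let _ : NormedAlgebra ℚ (X →L[ℝ] X) := NormedAlgebra.restrictScalars ℚ ℝ _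
  rw [add_smul]
  exact NormedSpace.exp_add_of_commute (((Commute.refl B).smul_left s).smul_right t)

/-- Comparison of the semigroups of two commuting bounded dissipative operators. -/
theorem norm_exp_smul_sub_exp_smul_le {B C : X →L[ℝ] X} (hB : ∀ x, inner ℝ (B x) x ≤ 0)
    (hC : ∀ x, inner ℝ (C x) x ≤ 0) (hBC : Commute B C) {t : ℝ} (ht : 0 ≤ t) (x : X) :
    ‖NormedSpace.exp (t • B) x - NormedSpace.exp (t • C) x‖ ≤ t * ‖B x - C x‖ := by
  let _ : NormedAlgebra ℚ (X →L[ℝ] X) := NormedAlgebra.restrictScalars ℚ ℝ _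
  -- The path s ↦ exp(sB) exp((t - s)C) x joins exp(tC) x to exp(tB) x. Written as on the left it is
  -- easy to differentiate; written as on the right its factors are contractions, so its speed is at
  -- most ‖Bx - Cx‖.
  have split (s : ℝ) : NormedSpace.exp (s • (B - C)) * NormedSpace.exp (t • C)
      = NormedSpace.exp (s • B) * NormedSpace.exp ((t - s) • C) := by
    rw [← NormedSpace.exp_add_of_commute, ← NormedSpace.exp_add_of_commute]
    · congr 1
      rw [smul_sub, sub_smul]
      abel
    · exact (hBC.smul_left s).smul_right (t - s)
    · exact ((hBC.sub_left (Commute.refl C)).smul_left s).smul_right t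
  have key := norm_image_sub_le_of_norm_deriv_le_segment' (a := 0) (b := t)
    (f := fun s : ℝ => NormedSpace.exp (s • (B - C)) (NormedSpace.exp (t • C) x))
    (C := ‖B x - C x‖)
    (fun s _ => (hasDerivAt_exp_smul_apply (B - C) (NormedSpace.exp (t • C) x) s).hasDerivWithinAt)
    (fun s hs => ?_) t ⟨ht, le_rfl⟩
  · have e0 := congrArg (fun T : X →L[ℝ] X => T x) (split t)
    simp only [mul_apply_eq_comp, sub_self, zero_smul, NormedSpace.exp_zero,
      one_apply_eq_self] at e0
    simp only [zero_smul, NormedSpace.exp_zero, one_apply_eq_self, e0, sub_zero] at key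
    linarith
  · have hc : Commute (B - C) (NormedSpace.exp (t • C)) :=
      ((hBC.sub_left (Commute.refl C)).smul_right t).exp_right
    have e : (B - C) (NormedSpace.exp (t • C) x) = NormedSpace.exp (t • C) ((B - C) x) :=
      congrArg (fun T : X →L[ℝ] X => T x) hc.eq
    rw [e]
    have e1 := congrArg (fun T : X →L[ℝ] X => T ((B - C) x)) (split s)
    simp only [mul_apply_eq_comp] at e1
    rw [e1]
    exact (norm_exp_smul_apply_le hB hs.1 _).trans
      (norm_exp_smul_apply_le hC (by linarith [hs.2]) _)

theorem norm_exp_smul_sub_self_le {B : X →L[ℝ] X} (hB : ∀ x, inner ℝ (B x) x ≤ 0) {t : ℝ}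
    (ht : 0 ≤ t) (x : X) : ‖NormedSpace.exp (t • B) x - x‖ ≤ t * ‖B x‖ := by
  simpa using norm_exp_smul_sub_exp_smul_le hB (C := 0) (by simp) (Commute.zero_right B) ht x

/-- The Lipschitz constant depends on B only through ‖Bx‖, so the bound survives the limit along
operators with B_n x convergent. -/
theorem norm_exp_smul_sub_le {B : X →L[ℝ] X} (hB : ∀ x, inner ℝ (B x) x ≤ 0) {s t : ℝ}
    (hs : 0 ≤ s) (ht : 0 ≤ t) (x : X) :
    ‖NormedSpace.exp (t • B) x - NormedSpace.exp (s • B) x‖ ≤ |t - s| * ‖B x‖ := by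
  wlog hst : s ≤ t generalizing s t
  · rw [norm_sub_rev, abs_sub_comm]
    exact this ht hs (le_of_not_ge hst)
  rw [abs_of_nonneg (sub_nonneg.2 hst)]
  have e : NormedSpace.exp (t • B) x
      = NormedSpace.exp (s • B) (NormedSpace.exp ((t - s) • B) x) := by
    rw [← mul_apply_eq_comp, ← exp_add_smul, add_sub_cancel]
  rw [e, ← map_sub]
  exact (norm_exp_smul_apply_le hB hs _).trans
    (norm_exp_smul_sub_self_le hB (sub_nonneg.2 hst) x)

/-- First order Taylor estimate for the semigroup of a bounded dissipative operator. -/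
theorem norm_exp_smul_sub_sub_le {B : X →L[ℝ] X} (hB : ∀ x, inner ℝ (B x) x ≤ 0) {t : ℝ}
    (ht : 0 ≤ t) (x z : X) : ‖NormedSpace.exp (t • B) x - x - t • B x‖
      ≤ t * (2 * ‖B x - z‖ + t * ‖B z‖) := by
  have key := norm_image_sub_le_of_norm_deriv_le_segment' (a := 0) (b := t)
    (f := fun s : ℝ => NormedSpace.exp (s • B) x - s • B x)
    (C := 2 * ‖B x - z‖ + t * ‖B z‖)
    (fun s _ => ((hasDerivAt_exp_smul_apply B x s).sub
      ((hasDerivAt_id s).smul_const (B x))).hasDerivWithinAt)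
    (fun s hs => ?_) t ⟨ht, le_rfl⟩
  · simp only [zero_smul, NormedSpace.exp_zero, one_apply_eq_self, sub_zero] at key
    rw [sub_right_comm]
    linarith
  -- The vector z stands in for Bx: in the limit Bx becomes Ax, which may lie outside D(A), so no
  -- bound may involve ‖B(Bx)‖.
  · have e : NormedSpace.exp (s • B) (B x) - (1 : ℝ) • B x
        = NormedSpace.exp (s • B) (B x - z) + (NormedSpace.exp (s • B) z - z) - (B x - z) := by
      rw [map_sub, one_smul]
      abel
    rw [e]
    have h1 := norm_exp_smul_apply_le hB hs.1 (B x - z)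
    have h2 := norm_exp_smul_sub_self_le hB hs.1 z
    have h3 : s * ‖B z‖ ≤ t * ‖B z‖ := by gcongr; exact hs.2.le
    have h4 := norm_sub_le (NormedSpace.exp (s • B) (B x - z) + (NormedSpace.exp (s • B) z - z))
      (B x - z)
    have h5 := norm_add_le (NormedSpace.exp (s • B) (B x - z)) (NormedSpace.exp (s • B) z - z)
    linarith

/-- The strong limit of the semigroups of commuting bounded dissipative operators. -/
theorem exists_c0Semigroup_of_tendsto {A : X →ₗ.[ℝ] X} (hdense : Dense (A.domain : Set X))
    {B : ℕ → X →L[ℝ] X} (hB : ∀ n x, inner ℝ (B n x) x ≤ 0) (hcomm : ∀ n m, Commute (B n) (B m))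
    (hlim : ∀ x : A.domain, Tendsto (fun n => B n x) atTop (𝓝 (A x))) :
    ∃ T : C0Semigroup X, (∀ t x, ‖T.S t x‖ ≤ ‖x‖) ∧
      ∀ x : A.domain, Tendsto (fun t : ℝ≥0 => (t : ℝ)⁻¹ • (T.S t x - x)) (𝓝[>] 0) (𝓝 (A x)) := by
  set E : ℕ → ℝ≥0 → X →L[ℝ] X := fun n t => NormedSpace.exp ((t : ℝ) • B n) with hE
  have hEc (n t x) : ‖E n t x‖ ≤ ‖x‖ := norm_exp_smul_apply_le (hB n) t.2 x
  have hcauchy (t : ℝ≥0) (x : X) : CauchySeq fun n => E n t x := by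
    rw [Metric.cauchySeq_iff']
    intro ε hε
    obtain ⟨z, hz, hxz⟩ := Metric.mem_closure_iff.1 (hdense x) (ε / 4) (by positivity)
    -- Dividing by t + 1 instead of t covers t = 0. Of the four quarters of ε, one is spent here and
    -- two on replacing x by z, which leaves a strict inequality.
    have hcz := Metric.cauchySeq_iff'.1 (hlim ⟨z, hz⟩).cauchySeq (ε / 4 / (t + 1)) (by positivity)
    obtain ⟨N, hN⟩ := hcz
    refine ⟨N, fun n hn => ?_⟩
    have h1 := norm_exp_smul_sub_exp_smul_le (hB n) (hB N) (hcomm n N) t.2 z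
    have h2 := hN n hn
    rw [dist_eq_norm] at h2 hxz ⊢
    have h3 : (t : ℝ) * ‖B n z - B N z‖ ≤ ε / 4 := by
      calc (t : ℝ) * ‖B n z - B N z‖ ≤ (t + 1) * (ε / 4 / (t + 1)) := by
            gcongr
            linarith
        _ = ε / 4 := by field_simp
    have e : E n t x - E N t x = E n t (x - z) + (E n t z - E N t z) - E N t (x - z) := by
      rw [map_sub, map_sub]
      abel
    rw [e]
    have h4 := norm_sub_le (E n t (x - z) + (E n t z - E N t z)) (E N t (x - z))
    have h5 := norm_add_le (E n t (x - z)) (E n t z - E N t z)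
    have h6 := hEc n t (x - z)
    have h7 := hEc N t (x - z)
    have h8 : ‖E n t z - E N t z‖ ≤ (t : ℝ) * ‖B n z - B N z‖ := h1
    linarith
  choose S hS using fun t x => cauchySeq_tendsto_of_complete (hcauchy t x)
  have hSn (t x) : ‖S t x‖ ≤ ‖x‖ :=
    le_of_tendsto (hS t x).norm (Eventually.of_forall fun n => hEc n t x)
  let SL : ℝ≥0 → X →L[ℝ] X := fun t => LinearMap.mkContinuous
    { toFun := S t
      map_add' := fun x y => tendsto_nhds_unique (hS t (x + y)) (by
        simpa using (hS t x).add (hS t y))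
      map_smul' := fun r x => tendsto_nhds_unique (hS t (r • x)) (by
        simpa using (hS t x).const_smul r) } 1 (fun x => by simpa using hSn t x)
  have hSL (t x) : SL t x = S t x := rfl
  have hlip (x : A.domain) (s t : ℝ≥0) : ‖S t x - S s x‖ ≤ |(t : ℝ) - s| * ‖A x‖ :=
    le_of_tendsto_of_tendsto ((hS t x).sub (hS s x)).norm ((hlim x).norm.const_mul _)
      (Eventually.of_forall fun n => norm_exp_smul_sub_le (hB n) s.2 t.2 (x : X))
  have htaylor (x z : A.domain) (t : ℝ≥0) :
      ‖S t x - x - (t : ℝ) • A x‖ ≤ t * (2 * ‖A x - z‖ + t * ‖A z‖) :=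
    le_of_tendsto_of_tendsto (((hS t x).sub_const _).sub ((hlim x).const_smul _)).norm
      (((((hlim x).sub_const _).norm.const_mul 2).add ((hlim z).norm.const_mul _)).const_mul _)
      (Eventually.of_forall fun n => norm_exp_smul_sub_sub_le (hB n) t.2 (x : X) (z : X))
  refine ⟨⟨SL, ?_, ?_, ?_⟩, hSn, ?_⟩
  · ext x
    refine tendsto_nhds_unique (hS 0 x) ?_
    simp [hE]
  · intro s t
    ext x
    refine tendsto_nhds_unique (hS (s + t) x) ?_
    -- Both the operator and its argument move with n; contractivity of `E n s` lets the argument be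
    -- frozen at its limit.
    have h1 : Tendsto (fun n => E n s (E n t x - S t x)) atTop (𝓝 0) := by
      refine squeeze_zero_norm (fun n => hEc n s _) ?_
      simpa using ((hS t x).sub_const (S t x)).norm
    have h2 := h1.add (hS s (S t x))
    rw [zero_add] at h2
    refine h2.congr fun n => ?_
    rw [← map_add, sub_add_cancel]
    simp only [hE, NNReal.coe_add]
    rw [exp_add_smul, mul_apply_eq_comp]
  · intro x
    -- Orbits starting in D(A) are Lipschitz, and by contractivity every orbit is a uniform limit of
    -- these.
    apply continuous_of_uniform_approx_of_continuous
    intro u hu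
    obtain ⟨ε, hε, hεu⟩ := Metric.mem_uniformity_dist.1 hu
    obtain ⟨z, hz, hxz⟩ := Metric.mem_closure_iff.1 (hdense x) ε hε
    refine ⟨fun t => S t z, ?_, fun t => hεu ?_⟩
    · refine LipschitzWith.continuous (K := ‖A ⟨z, hz⟩‖₊) (LipschitzWith.of_dist_le_mul ?_)
      intro t s
      rw [dist_eq_norm, NNReal.dist_eq, mul_comm]
      exact hlip ⟨z, hz⟩ s t
    · rw [dist_eq_norm]
      have : SL t x - S t z = SL t (x - z) := (map_sub (SL t) x z).symm
      rw [this]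
      rw [dist_eq_norm] at hxz
      exact (hSn t _).trans_lt hxz
  · intro x
    rw [Metric.tendsto_nhds]
    intro ε hε
    -- Here z in D(A) approximates Ax rather than x, as the Taylor estimate requires.
    obtain ⟨z, hz, hxz⟩ := Metric.mem_closure_iff.1 (hdense (A x)) (ε / 4) (by positivity)
    rw [dist_eq_norm] at hxz
    set M := ‖A ⟨z, hz⟩‖ with hM
    have hδ : ∀ᶠ t : ℝ≥0 in 𝓝[>] 0, (t : ℝ) * M < ε / 2 := by
      have : Tendsto (fun t : ℝ≥0 => (t : ℝ) * M) (𝓝 0) (𝓝 (((0 : ℝ≥0) : ℝ) * M)) :=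
        (by fun_prop : Continuous fun t : ℝ≥0 => (t : ℝ) * M).tendsto 0
      rw [NNReal.coe_zero, zero_mul] at this
      exact (this.mono_left nhdsWithin_le_nhds).eventually_lt_const (by positivity)
    filter_upwards [hδ, self_mem_nhdsWithin] with t ht ht0
    have ht1 : (0 : ℝ) < t := ht0
    have e : (t : ℝ)⁻¹ • (SL t x - x) - A x = (t : ℝ)⁻¹ • (S t x - x - (t : ℝ) • A x) := by
      rw [hSL, smul_sub _ (S t x - x), smul_smul, inv_mul_cancel₀ ht1.ne', one_smul]
    rw [dist_eq_norm, e, norm_smul, norm_inv, Real.norm_of_nonneg ht1.le]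
    have h1 := htaylor x ⟨z, hz⟩ t
    calc (t : ℝ)⁻¹ * ‖S t x - x - (t : ℝ) • A x‖
        ≤ (t : ℝ)⁻¹ * (t * (2 * ‖A x - z‖ + t * M)) := by gcongr
      _ = 2 * ‖A x - z‖ + t * M := by field_simp
      _ < ε := by linarith

end BoundedDissipative

/-! ### Resolvents of dissipative operators and the Lumer–Phillips theorem. -/

section LumerPhillips

variable {A : X →ₗ.[ℝ] X}

/-- By dissipativity μ‖x‖² ≤ ⟨(μ - A)x, x⟩, and Cauchy–Schwarz allows division by ‖x‖. -/
theorem norm_le_norm_subOp (hA : ∀ x : A.domain, inner ℝ (A x) (x : X) ≤ 0) (μ : ℝ)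
    (x : A.domain) : μ * ‖(x : X)‖ ≤ ‖subOp A μ x‖ := by
  rcases (norm_nonneg (x : X)).eq_or_lt with h0 | h0
  · rw [← h0, mul_zero]
    exact norm_nonneg _
  · have h1 : inner ℝ (subOp A μ x) (x : X) = μ * ‖(x : X)‖ ^ 2 - inner ℝ (A x) (x : X) := by
      rw [subOp_apply, inner_sub_left, real_inner_smul_left, real_inner_self_eq_norm_sq]
    have h2 := real_inner_le_norm (subOp A μ x) (x : X)
    have h3 := hA x
    nlinarith

theorem injective_subOp (hA : ∀ x : A.domain, inner ℝ (A x) (x : X) ≤ 0) {μ : ℝ}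
    (hμ : 0 < μ) : Function.Injective (subOp A μ) := by
  rw [injective_iff_map_eq_zero]
  intro x hx
  have h := norm_le_norm_subOp hA μ x
  rw [hx, norm_zero] at h
  have : ‖(x : X)‖ = 0 := by
    have := norm_nonneg (x : X)
    nlinarith
  exact Subtype.ext (norm_eq_zero.1 this)

/-- Every `μ > 0` is in the resolvent set of a dissipative operator with `μ - A` surjective. -/
theorem exists_resolvent (hA : ∀ x : A.domain, inner ℝ (A x) (x : X) ≤ 0) {μ : ℝ}
    (hμ : 0 < μ) (hs : Function.Surjective (subOp A μ)) :
    ∃ R : X →L[ℝ] X, (∀ x, R (subOp A μ x) = x) ∧ ∀ y, μ * ‖R y‖ ≤ ‖y‖ := by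
  let e := LinearEquiv.ofBijective (subOp A μ) ⟨injective_subOp hA hμ, hs⟩
  have hb (y : X) : μ * ‖(e.symm y : X)‖ ≤ ‖y‖ := by
    have h := norm_le_norm_subOp hA μ (e.symm y)
    have e1 : subOp A μ (e.symm y) = y := e.apply_symm_apply y
    rwa [e1] at h
  refine ⟨LinearMap.mkContinuous (A.domain.subtype ∘ₗ e.symm.toLinearMap) μ⁻¹ fun y => ?_,
    fun x => ?_, hb⟩
  · rw [← div_eq_inv_mul, le_div_iff₀ hμ, mul_comm]
    exact hb y
  · exact congrArg Subtype.val (e.symm_apply_apply x)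

/-- A vector orthogonal to D(A) has the form (1 - A)w; pairing it with w gives ‖w‖² = ⟨Aw, w⟩ ≤ 0.
-/
theorem dense_domain_of_surjective [CompleteSpace X]
    (hA : ∀ x : A.domain, inner ℝ (A x) (x : X) ≤ 0)
    (hs : Function.Surjective (subOp A 1)) : Dense (A.domain : Set X) := by
  rw [Submodule.dense_iff_topologicalClosure_eq_top,
    Submodule.topologicalClosure_eq_top_iff, Submodule.eq_bot_iff]
  intro v hv
  obtain ⟨w, rfl⟩ := hs v
  have h1 := (Submodule.mem_orthogonal _ _).1 hv w w.2
  rw [real_inner_comm, subOp_apply, inner_sub_left, one_smul, real_inner_self_eq_norm_sq] at h1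
  have h2 := hA w
  have h3 : ‖(w : X)‖ = 0 := by nlinarith
  have : w = 0 := Subtype.ext (norm_eq_zero.1 h3)
  rw [this, map_zero]

/-- The Lumer–Phillips theorem in a real Hilbert space. -/
theorem generatesC0Semigroup_of_dissipative [CompleteSpace X]
    (hA : ∀ x : A.domain, inner ℝ (A x) (x : X) ≤ 0)
    (hs : ∀ μ : ℝ, 0 < μ → Function.Surjective (subOp A μ)) : GeneratesC0Semigroup A := by
  have hdense := dense_domain_of_surjective hA (hs 1 one_pos)
  have hpos (n : ℕ) : (0 : ℝ) < n + 1 := by positivity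
  choose R hR hRn using fun n : ℕ => exists_resolvent hA (hpos n) (hs _ (hpos n))
  -- the resolvent identity
  have hRid (n m : ℕ) (y : X) : R m y = R n y + ((n : ℝ) - m) • R n (R m y) := by
    obtain ⟨x, rfl⟩ := hs _ (hpos m) y
    have e : subOp A (m + 1) x = subOp A (n + 1) x - ((n : ℝ) - m) • (x : X) := by
      rw [subOp_apply, subOp_apply, sub_right_comm, ← sub_smul]
      congr 2
      ring
    rw [hR m x, e, map_sub, hR n x, map_smul, sub_add_cancel]
  have hRcomm (n m : ℕ) : Commute (R n) (R m) := by
    -- Interchanging n and m in the resolvent identity gives commutation up to the factor n - m,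
    -- which is cancelled when nonzero.
    by_cases hnm : n = m
    · rw [hnm]
    · ext y
      have h1 := hRid n m y
      have h2 := hRid m n y
      have h3 : ((n : ℝ) - m) ≠ 0 := sub_ne_zero.2 (by exact_mod_cast hnm)
      have h4 : ((n : ℝ) - m) • R n (R m y) = ((n : ℝ) - m) • R m (R n y) := by
        have h5 : R m y - R n y = ((n : ℝ) - m) • R n (R m y) := sub_eq_of_eq_add' h1
        have h6 : R n y - R m y = ((m : ℝ) - n) • R m (R n y) := sub_eq_of_eq_add' h2
        rw [← h5, ← neg_sub (R n y), h6, ← neg_smul, neg_sub]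
      exact smul_right_injective X h3 h4
  -- the Yosida approximations
  set B : ℕ → X →L[ℝ] X := fun n => ((n : ℝ) + 1) • (((n : ℝ) + 1) • R n - 1) with hBdef
  have hB (n : ℕ) (x : X) : inner ℝ (B n x) x ≤ 0 := by
    have e : inner ℝ (B n x) x = ((n : ℝ) + 1) * (((n : ℝ) + 1) * inner ℝ (R n x) x - ‖x‖ ^ 2) := by
      simp only [hBdef, smul_apply, sub_apply,
        one_apply_eq_self, real_inner_smul_left, inner_sub_left,
        real_inner_self_eq_norm_sq]
    rw [e]
    have h1 := real_inner_le_norm (R n x) x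
    have h2 := hRn n x
    have h3 : ((n : ℝ) + 1) * inner ℝ (R n x) x ≤ ‖x‖ ^ 2 := by
      calc ((n : ℝ) + 1) * inner ℝ (R n x) x ≤ (n + 1) * (‖R n x‖ * ‖x‖) := by gcongr
        _ = ((n + 1) * ‖R n x‖) * ‖x‖ := by ring
        _ ≤ ‖x‖ * ‖x‖ := by gcongr
        _ = ‖x‖ ^ 2 := by ring
    exact mul_nonpos_of_nonneg_of_nonpos (hpos n).le (by linarith)
  have hBcomm (n m : ℕ) : Commute (B n) (B m) := by
    have h : Commute (((n : ℝ) + 1) • R n - 1) (((m : ℝ) + 1) • R m - 1) :=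
      (((hRcomm n m).smul_left _).smul_right _ |>.sub_right (Commute.one_right _)).sub_left
        (Commute.one_left _)
    exact (h.smul_left _).smul_right _
  -- On D(A) this gives B_n x = (n + 1) R_n (A x), so convergence of the Yosida approximations
  -- reduces to (n + 1) R_n y → y. The same identity proves that limit on D(A), since ‖R_n‖ ≤ 1/(n +
  -- 1); density does the rest.
  have hRA (n : ℕ) (x : A.domain) : ((n : ℝ) + 1) • R n x - x = R n (A x) := by
    have h := hR n x
    rw [subOp_apply, map_sub, map_smul] at h
    exact sub_eq_iff_eq_add.2 ((sub_eq_iff_eq_add.1 h).trans (add_comm _ _))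
  have hlim1 (y : X) : Tendsto (fun n : ℕ => ((n : ℝ) + 1) • R n y) atTop (𝓝 y) := by
    rw [Metric.tendsto_atTop]
    intro ε hε
    obtain ⟨z, hz, hyz⟩ := Metric.mem_closure_iff.1 (hdense y) (ε / 3) (by positivity)
    rw [dist_eq_norm] at hyz
    obtain ⟨N, hN⟩ := exists_nat_gt (‖A ⟨z, hz⟩‖ / (ε / 3))
    refine ⟨N, fun n hn => ?_⟩
    have hnN : (N : ℝ) ≤ n := by exact_mod_cast hn
    have h1 : ‖R n (A ⟨z, hz⟩)‖ < ε / 3 := by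
      rw [div_lt_iff₀ (by positivity)] at hN
      have h2 := hRn n (A ⟨z, hz⟩)
      have h3 : ‖A ⟨z, hz⟩‖ < ((n : ℝ) + 1) * (ε / 3) := by
        refine hN.trans_le ?_
        gcongr
        linarith
      exact lt_of_mul_lt_mul_left (h2.trans_lt h3) (hpos n).le
    have e : ((n : ℝ) + 1) • R n y - y
        = ((n : ℝ) + 1) • R n (y - z) + R n (A ⟨z, hz⟩) - (y - z) := by
      rw [← hRA n ⟨z, hz⟩, map_sub, smul_sub]
      abel
    rw [dist_eq_norm, e]
    have h4 := norm_sub_le (((n : ℝ) + 1) • R n (y - z) + R n (A ⟨z, hz⟩)) (y - z)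
    have h5 := norm_add_le (((n : ℝ) + 1) • R n (y - z)) (R n (A ⟨z, hz⟩))
    have h6 : ‖((n : ℝ) + 1) • R n (y - z)‖ ≤ ‖y - z‖ := by
      rw [norm_smul, Real.norm_of_nonneg (hpos n).le]
      exact hRn n _
    linarith
  have hlim (x : A.domain) : Tendsto (fun n => B n x) atTop (𝓝 (A x)) := by
    refine (hlim1 (A x)).congr fun n => ?_
    rw [← hRA n x]
    rfl
  obtain ⟨T, hT1, hT2⟩ := exists_c0Semigroup_of_tendsto hdense hB hBcomm hlim
  refine ⟨T, fun x y => ⟨fun h => ?_, fun h => ?_⟩⟩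
  · obtain ⟨x', h1, h2⟩ := (LinearPMap.mem_graph_iff A).1 h
    simp only at h1 h2
    rw [← h1, ← h2]
    exact hT2 x'
  -- The generator is no larger than A: if it maps x to y, solve (1 - A)z = x - y. Then x - z is
  -- fixed by the generator, which is dissipative because the semigroup is contractive, so x = z.
  · obtain ⟨z, hz⟩ := hs 1 one_pos (x - y)
    rw [subOp_apply, one_smul] at hz
    have h1 : Tendsto (fun t : ℝ≥0 => inner ℝ ((t : ℝ)⁻¹ • (T.S t (x - z) - (x - z))) (x - z))
        (𝓝[>] 0) (𝓝 (inner ℝ (y - A z) (x - z))) := by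
      refine ((h.sub (hT2 z)).congr fun t => ?_).inner tendsto_const_nhds
      rw [← smul_sub, map_sub]
      congr 1
      abel
    have h2 : inner ℝ (y - A z) (x - z) ≤ 0 := by
      refine le_of_tendsto h1 (Eventually.of_forall fun t => ?_)
      rw [real_inner_smul_left, inner_sub_left, real_inner_self_eq_norm_sq]
      have h3 := real_inner_le_norm (T.S t (x - z)) (x - z)
      have h4 : ‖T.S t (x - z)‖ * ‖x - (z : X)‖ ≤ ‖x - (z : X)‖ * ‖x - (z : X)‖ := by
        gcongr
        exact hT1 t _
      exact mul_nonpos_of_nonneg_of_nonpos (by positivity) (by nlinarith)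
    have e : y - A z = x - z := by
      rw [sub_eq_sub_iff_add_eq_add] at hz ⊢
      rw [add_comm y, hz, add_comm]
    rw [e, real_inner_self_eq_norm_sq] at h2
    have h5 : ‖x - (z : X)‖ = 0 := by nlinarith
    have h6 : x = z := sub_eq_zero.1 (norm_eq_zero.1 h5)
    refine (LinearPMap.mem_graph_iff A).2 ⟨z, h6.symm, ?_⟩
    rw [h6, sub_self] at e
    exact (sub_eq_zero.1 e).symm

end LumerPhillips

end Semigroups

/-! ### The initial value problem on one edge. -/

section EdgeEquation

variable {ℓ : ℝ}

/-- A continuous function on `[0, ℓ]` as an element of `L²(0, ℓ)`. -/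
def contToL2 (hℓ : 0 < ℓ) (F : C(Icc (0 : ℝ) ℓ, ℝ)) : L2 ℓ :=
  ((memLp_IccExtend hℓ F).mono_exponent le_top : MemLp _ 2 _).toLp

theorem contToL2_ae_eq (hℓ : 0 < ℓ) (F : C(Icc (0 : ℝ) ℓ, ℝ)) :
    (contToL2 hℓ F : ℝ → ℝ) =ᵐ[volume.restrict (Ioo 0 ℓ)] IccExtend hℓ.le F :=
  MemLp.coeFn_toLp _

/-- The primitive on `[0, ℓ]` with initial value `a` of a function in `L²(0, ℓ)`. -/
def primitive (hℓ : 0 < ℓ) (a : ℝ) (g : L2 ℓ) : C(Icc (0 : ℝ) ℓ, ℝ) where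
  toFun x := a + ∫ t in (0 : ℝ)..x, g t
  continuous_toFun := by
    have hc : ContinuousOn (fun x => a + ∫ t in (0 : ℝ)..x, g t) (Icc 0 ℓ) :=
      continuousOn_const.add (continuousOn_primitive hℓ g)
    exact continuousOn_iff_continuous_domRestrict.1 hc

theorem primitive_apply (hℓ : 0 < ℓ) (a : ℝ) (g : L2 ℓ) (x : Icc (0 : ℝ) ℓ) :
    primitive hℓ a g x = a + ∫ t in (0 : ℝ)..x, g t := rfl

theorem hasWeakDeriv_contToL2_primitive (hℓ : 0 < ℓ) (a : ℝ) (g : L2 ℓ) :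
    HasWeakDeriv (contToL2 hℓ (primitive hℓ a g)) g := by
  refine (hasWeakDeriv_iff hℓ).2 ⟨a, ?_⟩
  filter_upwards [contToL2_ae_eq hℓ (primitive hℓ a g), ae_restrict_mem measurableSet_Ioo]
    with x hx hx'
  rw [hx, IccExtend_eqOn hℓ _ (Ioo_subset_Icc_self hx'), primitive_apply]

/-- Lets boundary values of an H¹ class be read off from a given continuous function. -/
theorem contRep_eq_of_eq_contToL2 (hℓ : 0 < ℓ) {F : C(Icc (0 : ℝ) ℓ, ℝ)} {f : H1 ℓ}
    (h : (f : L2 ℓ) = contToL2 hℓ F) : contRep hℓ f = F := by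
  apply contRep_unique hℓ
  have := contToL2_ae_eq hℓ F
  rw [← h] at this
  exact (contRep_ae_eq hℓ f).symm.trans this

theorem intervalIntegrable_of_mem_Icc (hℓ : 0 < ℓ) (g : L2 ℓ) (x : Icc (0 : ℝ) ℓ) :
    IntervalIntegrable g volume 0 x :=
  (L2.intervalIntegrable hℓ.le g).mono_set (by
    rw [uIcc_of_le hℓ.le, uIcc_of_le x.2.1]
    exact Icc_subset_Icc_right x.2.2)

theorem ae_of_ae_Ioo {P : ℝ → Prop} (h : ∀ᵐ x ∂(volume.restrict (Ioo 0 ℓ)), P x)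
    (x : Icc (0 : ℝ) ℓ) : ∀ᵐ t, t ∈ Ioc 0 (x : ℝ) → P t := by
  filter_upwards [ae_Ioc_of_ae_Ioo h] with t ht ht'
  exact ht ⟨ht'.1, ht'.2.trans x.2.2⟩

/-- A Volterra-type map on `C[0, ℓ]` has a fixed point. -/
theorem exists_fixedPoint_of_volterra (hℓ : 0 < ℓ)
    (T : C(Icc (0 : ℝ) ℓ, ℝ) → C(Icc (0 : ℝ) ℓ, ℝ)) {K : ℝ}
    (hK : 0 ≤ K)
    (hT : ∀ u v x, |T u x - T v x|
      ≤ K * ∫ t in (0 : ℝ)..x, |IccExtend hℓ.le u t - IccExtend hℓ.le v t|) :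
    ∃ u, T u = u := by
  -- Picard's estimate: each application of the integral inequality contributes a factor Kx/(n + 1).
  have hiter (n : ℕ) (u v : C(Icc (0 : ℝ) ℓ, ℝ)) (x : Icc (0 : ℝ) ℓ) :
      |T^[n] u x - T^[n] v x| ≤ (K * x) ^ n / n.factorial * dist u v := by
    induction n generalizing x with
    | zero => simpa [Real.dist_eq] using ContinuousMap.dist_apply_le_dist (f := u) (g := v) x
    | succ n ih =>
      rw [Function.iterate_succ_apply', Function.iterate_succ_apply']
      refine (hT _ _ x).trans ?_
      have h1 : ∫ t in (0 : ℝ)..x, |IccExtend hℓ.le (T^[n] u) t - IccExtend hℓ.le (T^[n] v) t|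
          ≤ ∫ t in (0 : ℝ)..x, K ^ n / n.factorial * dist u v * t ^ n := by
        apply intervalIntegral.integral_mono_on x.2.1
        · exact (((T^[n] u).continuous.Icc_extend'.sub
            (T^[n] v).continuous.Icc_extend').abs).intervalIntegrable _ _
        · exact (by fun_prop : Continuous fun t : ℝ =>
            K ^ n / n.factorial * dist u v * t ^ n).intervalIntegrable _ _
        · intro t ht
          have ht' : t ∈ Icc 0 ℓ := ⟨ht.1, ht.2.trans x.2.2⟩
          rw [IccExtend_eqOn hℓ _ ht', IccExtend_eqOn hℓ _ ht']
          refine (ih ⟨t, ht'⟩).trans (le_of_eq ?_)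
          simp only [mul_pow]
          ring
      rw [intervalIntegral.integral_const_mul, integral_pow] at h1
      refine (mul_le_mul_of_nonneg_left h1 hK).trans (le_of_eq ?_)
      rw [Nat.factorial_succ]
      push_cast
      field_simp
      ring
  obtain ⟨n, hn⟩ := ((FloorSemiring.tendsto_pow_div_factorial_atTop (K * ℓ)).eventually_lt_const
    one_pos).exists
  have hn0 : 0 ≤ (K * ℓ) ^ n / n.factorial := by positivity
  have hcontr : ContractingWith ⟨(K * ℓ) ^ n / n.factorial, hn0⟩ T^[n] := by
    refine ⟨hn, LipschitzWith.of_dist_le_mul fun u v => ?_⟩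
    rw [ContinuousMap.dist_le (by positivity)]
    intro x
    rw [Real.dist_eq]
    refine (hiter n u v x).trans ?_
    have h0 : 0 ≤ K * x := mul_nonneg hK x.2.1
    have h1 : K * x ≤ K * ℓ := mul_le_mul_of_nonneg_left x.2.2 hK
    change _ ≤ (K * ℓ) ^ n / n.factorial * dist u v
    gcongr
  -- The unique fixed point of the contraction `T^[n]` is also fixed by `T`, since `T` commutes with
  -- its iterates.
  exact ⟨_, hcontr.isFixedPt_fixedPoint_iterate⟩

/-- The hypothesis is restricted to t ≤ x because the flux bound to which it is applied holds only
up to x. -/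
theorem abs_primitive_sub_le_const (hℓ : 0 < ℓ) {a : ℝ} {g g' : L2 ℓ} {x : Icc (0 : ℝ) ℓ} {M : ℝ}
    (h : ∀ᵐ t : ℝ ∂(volume.restrict (Ioo 0 ℓ)), t ≤ (x : ℝ) → |g t - g' t| ≤ M) :
    |primitive hℓ a g x - primitive hℓ a g' x| ≤ M * x := by
  rw [primitive_apply, primitive_apply, add_sub_add_left_eq_sub,
    ← intervalIntegral.integral_sub (intervalIntegrable_of_mem_Icc hℓ g x)
      (intervalIntegrable_of_mem_Icc hℓ g' x)]
  have := intervalIntegral.norm_integral_le_of_norm_le_const_ae (a := 0) (b := x)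
    (f := fun t => g t - g' t) (C := M) (by
      filter_upwards [ae_of_ae_Ioo h x] with t ht ht'
      rw [uIoc_of_le x.2.1] at ht'
      exact ht ht' ht'.2)
  rwa [sub_zero, abs_of_nonneg x.2.1] at this

theorem abs_primitive_sub_le_integral (hℓ : 0 < ℓ) {a : ℝ} {g g' : L2 ℓ} {x : Icc (0 : ℝ) ℓ}
    {b : ℝ → ℝ}
    (hb : Continuous b) (h : ∀ᵐ t ∂(volume.restrict (Ioo 0 ℓ)), |g t - g' t| ≤ b t) :
    |primitive hℓ a g x - primitive hℓ a g' x| ≤ ∫ t in (0 : ℝ)..x, b t := by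
  rw [primitive_apply, primitive_apply, add_sub_add_left_eq_sub,
    ← intervalIntegral.integral_sub (intervalIntegrable_of_mem_Icc hℓ g x)
      (intervalIntegrable_of_mem_Icc hℓ g' x)]
  exact intervalIntegral.norm_integral_le_of_norm_le (f := fun t => g t - g' t) x.2.1
    (ae_of_ae_Ioo h x) (hb.intervalIntegrable _ _)

theorem ae_abs_le_norm (p : Lp ℝ ∞ (volume.restrict (Ioo (0 : ℝ) ℓ))) :
    ∀ᵐ x ∂(volume.restrict (Ioo 0 ℓ)), |p x| ≤ ‖p‖ := by
  filter_upwards [ae_le_eLpNormEssSup (f := p) (μ := volume.restrict (Ioo (0 : ℝ) ℓ))] with x hx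
  have h2 := ENNReal.toReal_mono (by
    rw [← eLpNorm_exponent_top]
    exact Lp.eLpNorm_ne_top p) hx
  rw [Lp.norm_def, eLpNorm_exponent_top]
  simpa using h2

/-- The initial value problem on an edge: the equation `μ u - ((c u')' - p u) = h` has a solution
with prescribed value and flux at the left end point. -/
theorem exists_edge_solution (hℓ : 0 < ℓ) (c : C(Icc (0 : ℝ) ℓ, ℝ)) (hc : ∀ x, 0 < c x)
    (p : Lp ℝ ∞ (volume.restrict (Ioo (0 : ℝ) ℓ))) (μ : ℝ) (h : L2 ℓ) (α β : ℝ) :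
    ∃ u : edgeDomain hℓ c, μ • (u : L2 ℓ) - edgeOp hℓ c p u = h ∧
      edgeVal hℓ c ⟨0, le_rfl, hℓ.le⟩ u = α ∧
      contRep hℓ (edgeFlux hℓ c u) ⟨0, le_rfl, hℓ.le⟩ = β := by
  let ci : C(Icc (0 : ℝ) ℓ, ℝ) := ⟨fun x => (c x)⁻¹, c.continuous.inv₀ fun x => (hc x).ne'⟩
  -- The equation is treated as the first-order system u' = w/c, w' = (p + μ)u - h, which never
  -- differentiates c. `W u` is the flux determined by u, and fixed points of `T` are the solutions.
  let Λ : L2 ℓ → L2 ℓ := fun f => mulBdd p f + μ • f - h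
  let W : C(Icc (0 : ℝ) ℓ, ℝ) → C(Icc (0 : ℝ) ℓ, ℝ) := fun u =>
    primitive hℓ β (Λ (contToL2 hℓ u))
  let T : C(Icc (0 : ℝ) ℓ, ℝ) → C(Icc (0 : ℝ) ℓ, ℝ) := fun u =>
    primitive hℓ α (contToL2 hℓ (ci * W u))
  have hΛ (f g : L2 ℓ) : ∀ᵐ t ∂(volume.restrict (Ioo 0 ℓ)),
      |Λ f t - Λ g t| ≤ (‖p‖ + |μ|) * |f t - g t| := by
    filter_upwards [Lp.coeFn_sub (mulBdd p f + μ • f) h, Lp.coeFn_sub (mulBdd p g + μ • g) h,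
      Lp.coeFn_add (mulBdd p f) (μ • f), Lp.coeFn_add (mulBdd p g) (μ • g),
      Lp.coeFn_smul μ f, Lp.coeFn_smul μ g, mulBdd_ae_eq p f, mulBdd_ae_eq p g,
      ae_abs_le_norm p] with t h1 h2 h3 h4 h5 h6 h7 h8 h9
    have e : Λ f t - Λ g t = (p t + μ) * (f t - g t) := by
      simp only [Λ]
      rw [h1, h2, Pi.sub_apply, Pi.sub_apply, h3, h4, Pi.add_apply, Pi.add_apply, h5, h6,
        Pi.smul_apply, Pi.smul_apply, h7, h8, smul_eq_mul, smul_eq_mul]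
      ring
    rw [e, abs_mul]
    gcongr
    exact (abs_add_le _ _).trans (by gcongr)
  -- The double integral is reduced to a single one by extending the inner integral up to x; the
  -- outer one then costs a factor x ≤ ℓ.
  have hT (u v x) : |T u x - T v x| ≤ (‖ci‖ * (‖p‖ + |μ|) * ℓ) *
      ∫ t in (0 : ℝ)..x, |IccExtend hℓ.le u t - IccExtend hℓ.le v t| := by
    set b : ℝ → ℝ := fun t => |IccExtend hℓ.le u t - IccExtend hℓ.le v t| with hb
    have hbc : Continuous b := (u.continuous.Icc_extend'.sub v.continuous.Icc_extend').abs
    have hW (s : Icc (0 : ℝ) ℓ) (hs : (s : ℝ) ≤ x) :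
        |W u s - W v s| ≤ (‖p‖ + |μ|) * ∫ t in (0 : ℝ)..x, b t := by
      have h1 := abs_primitive_sub_le_integral hℓ (a := β) (x := s) (hbc.const_mul (‖p‖ + |μ|)) (by
        filter_upwards [hΛ (contToL2 hℓ u) (contToL2 hℓ v), contToL2_ae_eq hℓ u,
          contToL2_ae_eq hℓ v] with t h1 h2 h3
        rwa [h2, h3] at h1)
      rw [intervalIntegral.integral_const_mul] at h1
      refine h1.trans ?_
      gcongr
      exact intervalIntegral.integral_mono_interval le_rfl s.2.1 hs
        (ae_of_all _ fun t => abs_nonneg _) (hbc.intervalIntegrable _ _)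
    have h0 : 0 ≤ ∫ t in (0 : ℝ)..x, b t :=
      intervalIntegral.integral_nonneg x.2.1 fun t _ => abs_nonneg _
    have h2 := abs_primitive_sub_le_const hℓ (a := α) (x := x) (g := contToL2 hℓ (ci * W u))
      (g' := contToL2 hℓ (ci * W v)) (M := ‖ci‖ * ((‖p‖ + |μ|) * ∫ t in (0 : ℝ)..x, b t)) (by
        filter_upwards [contToL2_ae_eq hℓ (ci * W u), contToL2_ae_eq hℓ (ci * W v),
          ae_restrict_mem measurableSet_Ioo] with t h1 h2 h3 h4
        have h5 := Ioo_subset_Icc_self h3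
        rw [h1, h2, IccExtend_eqOn hℓ _ h5, IccExtend_eqOn hℓ _ h5, ContinuousMap.mul_apply,
          ContinuousMap.mul_apply, ← mul_sub, abs_mul]
        gcongr
        · exact ci.norm_coe_le_norm _
        · exact hW ⟨t, h5⟩ h4)
    refine h2.trans ?_
    calc _ ≤ ‖ci‖ * ((‖p‖ + |μ|) * ∫ t in (0 : ℝ)..x, b t) * ℓ := by
          gcongr
          exact x.2.2
      _ = _ := by ring
  obtain ⟨u, hu⟩ := exists_fixedPoint_of_volterra hℓ T (by positivity) hT
  have hf : HasWeakDeriv (contToL2 hℓ u) (contToL2 hℓ (ci * W u)) := by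
    have := hasWeakDeriv_contToL2_primitive hℓ α (contToL2 hℓ (ci * W u))
    change HasWeakDeriv (contToL2 hℓ (T u)) _ at this
    rwa [hu] at this
  have hw := hasWeakDeriv_contToL2_primitive hℓ β (Λ (contToL2 hℓ u))
  change HasWeakDeriv (contToL2 hℓ (W u)) _ at hw
  let f : H1 ℓ := ⟨contToL2 hℓ u, _, hf⟩
  have hdf : weakDeriv ℓ f = contToL2 hℓ (ci * W u) := (hasWeakDeriv_weakDeriv f).unique hf
  have hflux : mulBdd (contToLinf hℓ c) (weakDeriv ℓ f) = contToL2 hℓ (W u) := by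
    rw [hdf]
    apply Lp.ext
    filter_upwards [mulBdd_ae_eq (contToLinf hℓ c) (contToL2 hℓ (ci * W u)),
      contToLinf_ae_eq hℓ c, contToL2_ae_eq hℓ (ci * W u), contToL2_ae_eq hℓ (W u),
      ae_restrict_mem measurableSet_Ioo] with t h1 h2 h3 h4 h5
    have h6 := Ioo_subset_Icc_self h5
    rw [h1, h2, h3, h4, IccExtend_eqOn hℓ _ h6, IccExtend_eqOn hℓ _ h6, IccExtend_eqOn hℓ _ h6]
    exact mul_inv_cancel_left₀ (hc _).ne' _
  have hmem : contToL2 hℓ u ∈ edgeDomain hℓ c :=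
    mem_edgeDomain.2 ⟨f.2, by
      change mulBdd (contToLinf hℓ c) (weakDeriv ℓ f) ∈ H1 ℓ
      rw [hflux]
      exact ⟨_, hw⟩⟩
  let v : edgeDomain hℓ c := ⟨contToL2 hℓ u, hmem⟩
  have hfv : (edgeFlux hℓ c v : L2 ℓ) = contToL2 hℓ (W u) := hflux
  refine ⟨v, ?_, ?_, ?_⟩
  · have h1 : weakDeriv ℓ (edgeFlux hℓ c v) = Λ (contToL2 hℓ u) := by
      have := hasWeakDeriv_weakDeriv (edgeFlux hℓ c v)
      rw [hfv] at this
      exact this.unique hw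
    change μ • contToL2 hℓ u - (weakDeriv ℓ (edgeFlux hℓ c v) - mulBdd p (contToL2 hℓ u)) = h
    rw [h1]
    simp only [Λ]
    abel
  · change contRep hℓ _ _ = α
    rw [contRep_eq_of_eq_contToL2 hℓ (F := u) rfl, ← hu]
    simp only [T]
    rw [primitive_apply, intervalIntegral.integral_same, add_zero]
  · rw [contRep_eq_of_eq_contToL2 hℓ hfv]
    simp only [W]
    rw [primitive_apply, intervalIntegral.integral_same, add_zero]

end EdgeEquation

/-! ### Integration by parts and Green's inequality on one edge. -/

section Green

variable {ℓ : ℝ}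

theorem L2.inner_eq_intervalIntegral (hℓ : 0 < ℓ) (f g : L2 ℓ) :
    inner ℝ f g = ∫ x in (0 : ℝ)..ℓ, f x * g x := by
  rw [MeasureTheory.L2.inner_def, intervalIntegral.integral_of_le hℓ.le,
    integral_Ioc_eq_integral_Ioo]
  refine integral_congr_ae (ae_of_all _ fun x => ?_)
  simp [mul_comm]

/-- Integration by parts in `H¹(0, ℓ)`. -/
theorem inner_weakDeriv_left (hℓ : 0 < ℓ) (f g : H1 ℓ) :
    inner ℝ (weakDeriv ℓ f) (g : L2 ℓ)
      = contRep hℓ f ⟨ℓ, hℓ.le, le_rfl⟩ * contRep hℓ g ⟨ℓ, hℓ.le, le_rfl⟩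
        - contRep hℓ f ⟨0, le_rfl, hℓ.le⟩ * contRep hℓ g ⟨0, le_rfl, hℓ.le⟩
        - inner ℝ (f : L2 ℓ) (weakDeriv ℓ g) := by
  have hac (a : ℝ) (h : L2 ℓ) :
      AbsolutelyContinuousOnInterval (fun x => a + ∫ t in (0 : ℝ)..x, h t) 0 ℓ := by
    have c : AbsolutelyContinuousOnInterval (fun _ : ℝ => a) 0 ℓ :=
      (LipschitzWith.const a).lipschitzOnWith.absolutelyContinuousOnInterval
    exact c.add ((L2.intervalIntegrable hℓ.le h).absolutelyContinuousOnInterval_intervalIntegral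
      (by simp))
  have hder (a : ℝ) (h : L2 ℓ) : ∀ᵐ x, x ∈ Ioc 0 ℓ →
      deriv (fun x => a + ∫ t in (0 : ℝ)..x, h t) x = h x := by
    filter_upwards [(L2.intervalIntegrable hℓ.le h).ae_hasDerivAt_integral] with x hx hx'
    exact ((hx (by rw [uIcc_of_le hℓ.le]; exact Ioc_subset_Icc_self hx') 0
      (by simp)).const_add a).deriv
  obtain ⟨a, ha⟩ := contRep_eq_primitive hℓ f
  obtain ⟨b, hb⟩ := contRep_eq_primitive hℓ g
  have hrep (k : H1 ℓ) (r : ℝ)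
      (hr : ∀ x : Icc (0 : ℝ) ℓ, contRep hℓ k x = r + ∫ t in (0 : ℝ)..x, weakDeriv ℓ k t) :
      ∀ᵐ x, x ∈ Ioc 0 ℓ → (k : L2 ℓ) x = r + ∫ t in (0 : ℝ)..x, weakDeriv ℓ k t := by
    filter_upwards [ae_Ioc_of_ae_Ioo (contRep_ae_eq hℓ k)] with x hx hx'
    rw [hx hx', IccExtend_eqOn hℓ _ (Ioc_subset_Icc_self hx'), hr]
  have key := (hac a (weakDeriv ℓ f)).integral_mul_deriv_eq_deriv_mul (hac b (weakDeriv ℓ g))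
  have e1 : inner ℝ (weakDeriv ℓ f) (g : L2 ℓ) = ∫ x in (0 : ℝ)..ℓ,
      deriv (fun x => a + ∫ t in (0 : ℝ)..x, weakDeriv ℓ f t) x *
        (b + ∫ t in (0 : ℝ)..x, weakDeriv ℓ g t) := by
    rw [L2.inner_eq_intervalIntegral hℓ]
    apply intervalIntegral.integral_congr_ae
    filter_upwards [hder a (weakDeriv ℓ f), hrep g b hb] with x h1 h2 h3
    rw [uIoc_of_le hℓ.le] at h3
    rw [h1 h3, h2 h3]
  have e2 : inner ℝ (f : L2 ℓ) (weakDeriv ℓ g) = ∫ x in (0 : ℝ)..ℓ,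
      (a + ∫ t in (0 : ℝ)..x, weakDeriv ℓ f t) *
        deriv (fun x => b + ∫ t in (0 : ℝ)..x, weakDeriv ℓ g t) x := by
    rw [L2.inner_eq_intervalIntegral hℓ]
    apply intervalIntegral.integral_congr_ae
    filter_upwards [hder b (weakDeriv ℓ g), hrep f a ha] with x h1 h2 h3
    rw [uIoc_of_le hℓ.le] at h3
    rw [h1 h3, h2 h3]
  rw [e1, e2, key, ha, ha, hb, hb]
  ring

theorem inner_mulBdd_nonneg (hℓ : 0 < ℓ) {a : Lp ℝ ∞ (volume.restrict (Ioo (0 : ℝ) ℓ))}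
    (ha : ∀ᵐ x ∂(volume.restrict (Ioo 0 ℓ)), 0 ≤ a x) (f : L2 ℓ) :
    0 ≤ inner ℝ (mulBdd a f) f := by
  rw [L2.inner_eq_intervalIntegral hℓ, intervalIntegral.integral_of_le hℓ.le,
    integral_Ioc_eq_integral_Ioo]
  apply integral_nonneg_of_ae
  filter_upwards [ha, mulBdd_ae_eq a f] with x h1 h2
  rw [h2, mul_assoc]
  exact mul_nonneg h1 (mul_self_nonneg _)

/-- Green's inequality on an edge. -/
theorem inner_edgeOp_le (hℓ : 0 < ℓ) (c : C(Icc (0 : ℝ) ℓ, ℝ)) (hc : ∀ x, 0 < c x)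
    {p : Lp ℝ ∞ (volume.restrict (Ioo (0 : ℝ) ℓ))}
    (hp : ∀ᵐ x ∂(volume.restrict (Ioo 0 ℓ)), 0 ≤ p x) (u : edgeDomain hℓ c) :
    inner ℝ (edgeOp hℓ c p u) (u : L2 ℓ)
      ≤ contRep hℓ (edgeFlux hℓ c u) ⟨ℓ, hℓ.le, le_rfl⟩ * edgeVal hℓ c ⟨ℓ, hℓ.le, le_rfl⟩ u
        - contRep hℓ (edgeFlux hℓ c u) ⟨0, le_rfl, hℓ.le⟩ * edgeVal hℓ c ⟨0, le_rfl, hℓ.le⟩ u := by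
  set u₁ := Submodule.inclusion (edgeDomain_le hℓ c) u with hu₁
  have h1 := inner_weakDeriv_left hℓ (edgeFlux hℓ c u) u₁
  have h2 := inner_mulBdd_nonneg hℓ hp (u : L2 ℓ)
  -- The flux is c u' by construction, so this pairing is ∫ c u'².
  have h3 : 0 ≤ inner ℝ (edgeFlux hℓ c u : L2 ℓ) (weakDeriv ℓ u₁) := by
    refine inner_mulBdd_nonneg hℓ ?_ (weakDeriv ℓ u₁)
    filter_upwards [contToLinf_ae_eq hℓ c, ae_restrict_mem measurableSet_Ioo] with x h4 h5
    rw [h4, IccExtend_eqOn hℓ _ (Ioo_subset_Icc_self h5)]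
    exact (hc _).le
  have e : inner ℝ (edgeOp hℓ c p u) (u : L2 ℓ)
      = inner ℝ (weakDeriv ℓ (edgeFlux hℓ c u)) (u₁ : L2 ℓ)
        - inner ℝ (mulBdd p (u : L2 ℓ)) (u : L2 ℓ) :=
    inner_sub_left _ _ _
  rw [e, h1]
  change _ - _ - _ - _ ≤ _ * contRep hℓ u₁ _ - _ * contRep hℓ u₁ _
  linarith

end Green

/-! ### Vertex conditions and dissipativity on the graph. -/

namespace QuantumGraph

variable {V : Type*} [Fintype V] [DecidableEq V] (Γ : QuantumGraph V)

/-- Absence of loops is what makes `endpoint` and `outward`, which test only the source, correct at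
the target too. -/
theorem src_ne_tgt (e : Γ.graph.edgeSet) : Γ.src e ≠ Γ.tgt e := by
  have h := e.2
  rw [← Γ.ends e, SimpleGraph.mem_edgeSet] at h
  exact h.ne

theorem mem_edge_iff (v : V) (e : Γ.graph.edgeSet) :
    v ∈ (e : Sym2 V) ↔ v = Γ.src e ∨ v = Γ.tgt e := by
  rw [← Γ.ends e, Sym2.mem_iff]

/-- A sum over all incident pairs of a vertex and an edge. -/
theorem sum_sum_enum (φ : V → Γ.graph.edgeSet → ℝ) :
    ∑ v, ∑ i, φ v (Γ.enum v i) = ∑ e, (φ (Γ.src e) e + φ (Γ.tgt e) e) := by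
  have h1 (v : V) : ∑ i, φ v (Γ.enum v i) =
      ∑ e : Γ.graph.edgeSet, if v ∈ (e : Sym2 V) then φ v e else 0 := by
    rw [← Finset.sum_filter, Equiv.sum_comp (Γ.enum v) fun e => φ v e]
    exact (Finset.sum_subtype _ (by simp) _).symm
  simp_rw [h1]
  rw [Finset.sum_comm]
  refine Finset.sum_congr rfl fun e _ => ?_
  rw [← Finset.sum_filter, ← Finset.sum_pair (f := fun v => φ v e) (Γ.src_ne_tgt e)]
  refine Finset.sum_congr ?_ fun _ _ => rfl
  ext v
  simp [mem_edge_iff]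

theorem endpoint_src (e : Γ.graph.edgeSet) :
    Γ.endpoint (Γ.src e) e = ⟨0, le_rfl, (Γ.length_pos e).le⟩ := if_pos rfl

theorem endpoint_tgt (e : Γ.graph.edgeSet) :
    Γ.endpoint (Γ.tgt e) e = ⟨Γ.length e, (Γ.length_pos e).le, le_rfl⟩ :=
  if_neg (Γ.src_ne_tgt e)

theorem outward_src (e : Γ.graph.edgeSet) : Γ.outward (Γ.src e) e = 1 := if_pos rfl

theorem outward_tgt (e : Γ.graph.edgeSet) : Γ.outward (Γ.tgt e) e = -1 :=
  if_neg (Γ.src_ne_tgt e)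

theorem contMatrix_mulVec {d : ℕ} (U : Fin d → ℝ) (i : Fin (d - 1)) :
    (contMatrix d).mulVec U i = U ⟨i, by omega⟩ - U ⟨i + 1, by omega⟩ := by
  have h (j : Fin d) : contMatrix d i j * U j
      = (if j = ⟨i, by omega⟩ then U j else 0) - if j = ⟨i + 1, by omega⟩ then U j else 0 := by
    simp only [contMatrix, Matrix.of_apply, Fin.ext_iff]
    split_ifs <;> first | omega | ring
  simp only [Matrix.mulVec, dotProduct, h, Finset.sum_sub_distrib, Finset.sum_ite_eq',
    Finset.mem_univ, if_true]

theorem eq_of_contMatrix_mulVec_eq_zero {d : ℕ} {U : Fin d → ℝ}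
    (h : (contMatrix d).mulVec U = 0) (i j : Fin d) : U i = U j := by
  have h0 (k : ℕ) (hk : k < d) : U ⟨k, hk⟩ = U ⟨0, by omega⟩ := by
    induction k with
    | zero => rfl
    | succ k ih =>
      have := congrFun h ⟨k, by omega⟩
      rw [contMatrix_mulVec, Pi.zero_apply, sub_eq_zero] at this
      rw [← ih (by omega), this]
  exact (h0 i i.2).trans (h0 j j.2).symm

/-- The flux of `u` out of the vertex `v` into the edge `e`. -/
def outFlux (u : Γ.Amax.domain) (v : V) (e : Γ.graph.edgeSet) : ℝ :=
  Γ.outward v e * contRep (Γ.length_pos e) (edgeFlux (Γ.length_pos e) (Γ.cond e) (Γ.comp e u))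
    (Γ.endpoint v e)

/-- The conductance in the row C(v)ᵀ cancels the division by c in `edgeDeriv`, leaving only the
fluxes that occur in Green's formula. -/
theorem kirchhoffOp_apply (u : Γ.Amax.domain) (v : V) :
    Γ.kirchhoffOp u v = ∑ i, Γ.outFlux u v (Γ.enum v i) := by
  change ∑ i, Γ.condRow v i * Γ.vertexDeriv v u i = _
  refine Finset.sum_congr rfl fun i _ => ?_
  change Γ.cond _ (Γ.endpoint v _) * (Γ.outward v _ * (_ / Γ.cond _ (Γ.endpoint v _))) = _
  rw [mul_left_comm, mul_div_cancel₀ _ (Γ.cond_pos _ _).ne']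
  rfl

/-- `A_max` is dissipative on the kernel of the boundary operator. -/
theorem inner_Amax_nonpos (u : Γ.Amax.domain) (h1 : Γ.contOp u = 0) (h2 : Γ.kirchhoffOp u = 0) :
    inner ℝ (Γ.Amax u) (u : Γ.H) ≤ 0 := by
  let val : V → Γ.graph.edgeSet → ℝ := fun v e =>
    edgeVal (Γ.length_pos e) (Γ.cond e) (Γ.endpoint v e) (Γ.comp e u)
  -- The outward signs give both end points of an edge the same form, so that the sum can be
  -- rearranged over vertices.
  have hedge : inner ℝ (Γ.Amax u) (u : Γ.H)
      ≤ ∑ e, -(Γ.outFlux u (Γ.src e) e * val (Γ.src e) e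
        + Γ.outFlux u (Γ.tgt e) e * val (Γ.tgt e) e) := by
    rw [PiLp.inner_apply]
    refine Finset.sum_le_sum fun e _ => ?_
    refine (inner_edgeOp_le (Γ.length_pos e) (Γ.cond e) (Γ.cond_pos e) (Γ.pot_nonneg e)
      (Γ.comp e u)).trans (le_of_eq ?_)
    simp only [outFlux, val, endpoint_src, endpoint_tgt, outward_src, outward_tgt]
    ring
  refine hedge.trans (le_of_eq ?_)
  rw [Finset.sum_neg_distrib, neg_eq_zero, ← Γ.sum_sum_enum fun v e => Γ.outFlux u v e * val v e]
  refine Finset.sum_eq_zero fun v _ => ?_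
  have hcont : (contMatrix (Γ.graph.degree v)).mulVec (Γ.vertexVal v u) = 0 :=
    funext fun i => congrFun h1 ⟨v, i⟩
  have hval (i j) : val v (Γ.enum v i) = val v (Γ.enum v j) :=
    eq_of_contMatrix_mulVec_eq_zero hcont i j
  rcases isEmpty_or_nonempty (Fin (Γ.graph.degree v)) with hd | ⟨⟨i₀⟩⟩
  · exact Finset.sum_of_isEmpty _
  · simp_rw [fun i => hval i i₀]
    rw [← Finset.sum_mul, ← kirchhoffOp_apply, h2, Pi.zero_apply, zero_mul]

end QuantumGraph

/-! ### Dirichlet operators for abstract boundary conditions. -/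

/-- If `T` is the restriction of `M` to the kernel of a surjective boundary operator `B` with
values in a finite-dimensional space, then the Dirichlet operator exists on the resolvent set
of `T`. -/
theorem exists_isDirichletOperator {X Y : Type*} [NormedAddCommGroup X] [NormedSpace ℝ X]
    [NormedAddCommGroup Y] [NormedSpace ℝ Y] [FiniteDimensional ℝ Y] {M T : X →ₗ.[ℝ] X}
    {B : M.domain →ₗ[ℝ] Y} (hle : T ≤ M) (hdom : ∀ x : M.domain, (x : X) ∈ T.domain ↔ B x = 0)
    (hB : Function.Surjective B) {μ : ℝ} (hμ : μ ∈ resolventSet T) :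
    ∃ D : Y →L[ℝ] X, IsDirichletOperator M B μ D := by
  have hval (x : M.domain) (hx : (x : X) ∈ T.domain) : subOp T μ ⟨x, hx⟩ = subOp M μ x := by
    rw [subOp_apply, subOp_apply, hle.2 (x := ⟨x, hx⟩) (y := x) rfl]
  have hbij : Function.Bijective (B.domRestrict (LinearMap.ker (subOp M μ))) := by
    constructor
    -- An element of Ker(μ - M) killed by B lies in D(T), where μ - T is injective.
    · rw [injective_iff_map_eq_zero]
      rintro ⟨x, hx⟩ hBx
      have hxT := (hdom x).2 hBx
      have h0 : (⟨x, hxT⟩ : T.domain) = 0 := hμ.1.1 (by rw [hval, map_zero]; exact hx)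
      have h1 : (x : X) = 0 := congrArg Subtype.val h0
      exact Subtype.ext (Subtype.ext h1)
    · intro y
      obtain ⟨x, rfl⟩ := hB y
      -- Subtracting z moves the preimage x into Ker(μ - M) without changing its boundary value,
      -- because B vanishes on D(T).
      obtain ⟨z, hz⟩ := hμ.1.2 (subOp M μ x)
      let z' : M.domain := ⟨z, hle.1 z.2⟩
      have hz' : subOp M μ z' = subOp M μ x := by rw [← hz, ← hval z' z.2]
      refine ⟨⟨x - z', by rw [LinearMap.mem_ker, map_sub, hz', sub_self]⟩, ?_⟩
      change B (x - z') = B x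
      rw [map_sub, (hdom z').1 z.2, sub_zero]
  let e := LinearEquiv.ofBijective _ hbij
  -- Boundedness is automatic, the inverse being defined on a finite-dimensional space.
  refine ⟨LinearMap.toContinuousLinearMap
    (M.domain.subtype ∘ₗ Submodule.subtype _ ∘ₗ e.symm.toLinearMap), hbij, fun u => ?_⟩
  exact congrArg (fun w : LinearMap.ker (subOp M μ) => ((w : M.domain) : X)) (e.symm_apply_apply u)

/-! ### Dimension count, resolvent and generation on the graph. -/

namespace QuantumGraph

variable {V : Type*} [Fintype V] [DecidableEq V] (Γ : QuantumGraph V)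

/-- The value and the flux at the initial point of every edge. -/
def initialData : Γ.Amax.domain →ₗ[ℝ] (Γ.graph.edgeSet → ℝ × ℝ) where
  toFun u e := (edgeVal (Γ.length_pos e) (Γ.cond e) ⟨0, le_rfl, (Γ.length_pos e).le⟩ (Γ.comp e u),
    contRep (Γ.length_pos e) (edgeFlux (Γ.length_pos e) (Γ.cond e) (Γ.comp e u))
      ⟨0, le_rfl, (Γ.length_pos e).le⟩)
  map_add' u w := by
    funext e
    have h : Γ.comp e (u + w) = Γ.comp e u + Γ.comp e w := rfl
    ext <;> simp [h]
  map_smul' r u := by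
    funext e
    have h : Γ.comp e (r • u) = r • Γ.comp e u := rfl
    ext <;> simp [h]

/-- Without vertex conditions the edges decouple. The case h = 0 bounds the dimension of the kernel
from below; the case a = 0 gives surjectivity of μ - A_max. -/
theorem exists_subOp_Amax_eq (μ : ℝ) (h : Γ.H) (a : Γ.graph.edgeSet → ℝ × ℝ) :
    ∃ u, subOp Γ.Amax μ u = h ∧ Γ.initialData u = a := by
  choose u h1 h2 h3 using fun e => exists_edge_solution (Γ.length_pos e) (Γ.cond e)
    (Γ.cond_pos e) (Γ.pot e) μ (h e) (a e).1 (a e).2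
  refine ⟨⟨WithLp.toLp 2 fun e => (u e : L2 (Γ.length e)), fun e => (u e).2⟩, ?_, ?_⟩
  · ext1 e
    exact h1 e
  · funext e
    exact Prod.ext (h2 e) (h3 e)

theorem B_eq_zero_iff (u : Γ.Amax.domain) :
    Γ.B u = 0 ↔ Γ.contOp u = 0 ∧ Γ.kirchhoffOp u = 0 := by
  constructor
  · intro h
    exact ⟨funext fun i => congrArg (fun y : Γ.Y => y (Sum.inl i)) h,
      funext fun v => congrArg (fun y : Γ.Y => y (Sum.inr v)) h⟩
  · rintro ⟨h1, h2⟩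
    ext i
    rcases i with i | i
    · exact congrFun h1 i
    · exact congrFun h2 i

theorem mem_A_domain_iff (u : Γ.Amax.domain) : (u : Γ.H) ∈ Γ.A.domain ↔ Γ.B u = 0 := by
  constructor
  · rintro ⟨⟨w, hw, hwu⟩, -⟩
    rwa [← (Subtype.ext hwu : w = u)]
  · intro h
    exact ⟨⟨u, h, rfl⟩, u.2⟩

theorem A_le_Amax : Γ.A ≤ Γ.Amax := LinearPMap.domRestrict_le

theorem mem_AKmax_domain_iff (u : Γ.Amax.domain) :
    (u : Γ.H) ∈ Γ.AKmax.domain ↔ Γ.contOp u = 0 := by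
  constructor
  · rintro ⟨⟨w, hw, hwu⟩, -⟩
    rwa [← (Subtype.ext hwu : w = u)]
  · intro h
    exact ⟨⟨u, h, rfl⟩, u.2⟩

theorem mem_AK_domain_iff (u : Γ.AKmax.domain) : (u : Γ.H) ∈ Γ.AK.domain ↔ Γ.BK u = 0 := by
  constructor
  · rintro ⟨⟨w, hw, hwu⟩, -⟩
    rwa [← (Subtype.ext hwu : w = u)]
  · intro h
    exact ⟨⟨u, h, rfl⟩, u.2⟩

theorem AK_le_AKmax : Γ.AK ≤ Γ.AKmax := LinearPMap.domRestrict_le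

theorem BK_apply (u : Γ.Amax.domain) (hu : (u : Γ.H) ∈ Γ.AKmax.domain) :
    Γ.BK ⟨u, hu⟩ = WithLp.toLp 2 (Γ.kirchhoffOp u) := rfl

theorem AK_eq_A : Γ.AK = Γ.A := by
  have hmax : Γ.AK ≤ Γ.Amax := Γ.AK_le_AKmax.trans LinearPMap.domRestrict_le
  have hdom : Γ.AK.domain = Γ.A.domain := by
    ext x
    constructor
    · intro hx
      have hx1 := Γ.AK_le_AKmax.1 hx
      have hx2 := hmax.1 hx
      refine (Γ.mem_A_domain_iff ⟨x, hx2⟩).2 ((Γ.B_eq_zero_iff _).2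
        ⟨(Γ.mem_AKmax_domain_iff ⟨x, hx2⟩).1 hx1, ?_⟩)
      have := (Γ.mem_AK_domain_iff ⟨x, hx1⟩).1 hx
      rw [Γ.BK_apply ⟨x, hx2⟩ hx1] at this
      exact congrArg WithLp.ofLp this
    · intro hx
      have hx2 := Γ.A_le_Amax.1 hx
      obtain ⟨h1, h2⟩ := (Γ.B_eq_zero_iff _).1 ((Γ.mem_A_domain_iff ⟨x, hx2⟩).1 hx)
      have hx1 := (Γ.mem_AKmax_domain_iff ⟨x, hx2⟩).2 h1
      refine (Γ.mem_AK_domain_iff ⟨x, hx1⟩).2 ?_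
      rw [Γ.BK_apply ⟨x, hx2⟩ hx1, h2]
      rfl
  refine LinearPMap.ext hdom fun x hx hx' => ?_
  rw [hmax.2 (x := ⟨x, hx⟩) (y := ⟨x, hmax.1 hx⟩) rfl,
    Γ.A_le_Amax.2 (x := ⟨x, hx'⟩) (y := ⟨x, hmax.1 hx⟩) rfl]

theorem inner_A_nonpos (x : Γ.A.domain) : inner ℝ (Γ.A x) (x : Γ.H) ≤ 0 := by
  have hx := Γ.A_le_Amax.1 x.2
  obtain ⟨h1, h2⟩ := (Γ.B_eq_zero_iff _).1 ((Γ.mem_A_domain_iff ⟨x, hx⟩).1 x.2)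
  rw [Γ.A_le_Amax.2 (x := x) (y := ⟨x, hx⟩) rfl]
  exact Γ.inner_Amax_nonpos _ h1 h2

theorem bijective_B_ker (hdeg : ∀ v, 0 < Γ.graph.degree v) {μ : ℝ} (hμ : 0 < μ) :
    Function.Bijective (Γ.B.domRestrict (LinearMap.ker (subOp Γ.Amax μ))) := by
  have hinj : Function.Injective (Γ.B.domRestrict (LinearMap.ker (subOp Γ.Amax μ))) := by
    rw [injective_iff_map_eq_zero]
    rintro ⟨u, hu⟩ hBu
    have huA := (Γ.mem_A_domain_iff u).2 hBu
    have h0 : (⟨u, huA⟩ : Γ.A.domain) = 0 := by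
      refine injective_subOp Γ.inner_A_nonpos hμ ?_
      rw [map_zero, subOp_apply, Γ.A_le_Amax.2 (x := ⟨u, huA⟩) (y := u) rfl]
      exact hu
    have h1 : (u : Γ.H) = 0 := congrArg Subtype.val h0
    exact Subtype.ext (Subtype.ext h1)
  -- Finite dimension of the kernel comes from injectivity of B and is needed before ranks can be
  -- compared: at most 2m by B, at least 2m by the two initial data per edge.
  have hfin : Module.Finite ℝ (LinearMap.ker (subOp Γ.Amax μ)) := Module.Finite.of_injective _ hinj
  have hsurj : Function.Surjective
      (Γ.initialData.domRestrict (LinearMap.ker (subOp Γ.Amax μ))) := by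
    intro a
    obtain ⟨u, h1, h2⟩ := Γ.exists_subOp_Amax_eq μ 0 a
    exact ⟨⟨u, h1⟩, h2⟩
  have hle := LinearMap.finrank_le_finrank_of_injective hinj
  have hge := LinearMap.finrank_le_finrank_of_surjective hsurj
  rw [Module.finrank_pi_fintype] at hge
  simp only [Module.finrank_prod, Module.finrank_self, Finset.sum_const, Finset.card_univ,
    smul_eq_mul] at hge
  have hY := Γ.finrank_Y hdeg
  exact ⟨hinj, (LinearMap.injective_iff_surjective_of_finrank_eq_finrank (by omega)).1 hinj⟩

theorem surjective_B (hdeg : ∀ v, 0 < Γ.graph.degree v) : Function.Surjective Γ.B := by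
  intro y
  obtain ⟨u, hu⟩ := (Γ.bijective_B_ker hdeg one_pos).2 y
  exact ⟨u, hu⟩

/-- A preimage under B of data with zero continuity part already lies in D(A_{K,max}). -/
theorem surjective_BK (hdeg : ∀ v, 0 < Γ.graph.degree v) : Function.Surjective Γ.BK := by
  intro y
  obtain ⟨u, hu⟩ := Γ.surjective_B hdeg (WithLp.toLp 2 (Sum.elim 0 y))
  have h1 : Γ.contOp u = 0 := funext fun i => congrArg (fun y : Γ.Y => y (Sum.inl i)) hu
  refine ⟨⟨u, (Γ.mem_AKmax_domain_iff u).2 h1⟩, ?_⟩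
  rw [BK_apply]
  ext v
  exact congrArg (fun y : Γ.Y => y (Sum.inr v)) hu

theorem surjective_subOp_A (hdeg : ∀ v, 0 < Γ.graph.degree v) {μ : ℝ} (hμ : 0 < μ) :
    Function.Surjective (subOp Γ.A μ) := by
  intro h
  obtain ⟨u, hu, -⟩ := Γ.exists_subOp_Amax_eq μ h 0
  -- The kernel element w has the boundary data of u, so u - w satisfies the vertex conditions and
  -- still solves the equation.
  obtain ⟨⟨w, hw⟩, hwu⟩ := (Γ.bijective_B_ker hdeg hμ).2 (Γ.B u)
  have hmem : ((u - w : Γ.Amax.domain) : Γ.H) ∈ Γ.A.domain := by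
    rw [mem_A_domain_iff, map_sub, sub_eq_zero]
    exact hwu.symm
  refine ⟨⟨_, hmem⟩, ?_⟩
  rw [subOp_apply, Γ.A_le_Amax.2 (x := ⟨_, hmem⟩) (y := u - w) rfl]
  change subOp Γ.Amax μ (u - w) = h
  rw [map_sub, hu, LinearMap.mem_ker.1 hw, sub_zero]

theorem mem_resolventSet_A (hdeg : ∀ v, 0 < Γ.graph.degree v) {μ : ℝ} (hμ : 0 < μ) :
    μ ∈ resolventSet Γ.A := by
  have hs := Γ.surjective_subOp_A hdeg hμ
  obtain ⟨R, hR, -⟩ := exists_resolvent Γ.inner_A_nonpos hμ hs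
  exact ⟨⟨injective_subOp Γ.inner_A_nonpos hμ, hs⟩, R, hR⟩

theorem generatesC0Semigroup_A (hdeg : ∀ v, 0 < Γ.graph.degree v) : GeneratesC0Semigroup Γ.A :=
  generatesC0Semigroup_of_dissipative Γ.inner_A_nonpos fun _ hμ => Γ.surjective_subOp_A hdeg hμ

end QuantumGraph

end QG

end

theorem mainTheorem7 {V : Type*} [Fintype V] [DecidableEq V] (Γ : QG.QuantumGraph V)
    (hdeg : ∀ v, 0 < Γ.graph.degree v) :
    (QG.GeneratesC0Semigroup Γ.A ∧
      ∀ μ ∈ QG.resolventSet Γ.A, ∃ D : Γ.Y →L[ℝ] Γ.H, QG.IsDirichletOperator Γ.Amax Γ.B μ D) ∧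
    (Γ.AK = Γ.A ∧ QG.GeneratesC0Semigroup Γ.AK ∧
      ∀ μ : ℝ, 0 < μ ∨ μ ∈ QG.resolventSet Γ.AK →
        ∃ D : Γ.YK →L[ℝ] Γ.H, QG.IsDirichletOperator Γ.AKmax Γ.BK μ D) := by
  refine ⟨⟨Γ.generatesC0Semigroup_A hdeg, fun μ hμ => ?_⟩, Γ.AK_eq_A, ?_, fun μ hμ => ?_⟩
  · exact QG.exists_isDirichletOperator Γ.A_le_Amax Γ.mem_A_domain_iff (Γ.surjective_B hdeg) hμ
  · rw [Γ.AK_eq_A]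
    exact Γ.generatesC0Semigroup_A hdeg
  -- The case μ > 0 is an instance of the resolvent case, by dissipativity and surjectivity of μ -
  -- A.
  · refine QG.exists_isDirichletOperator Γ.AK_le_AKmax Γ.mem_AK_domain_iff
      (Γ.surjective_BK hdeg) (hμ.elim (fun h => ?_) id)
    rw [Γ.AK_eq_A]
    exact Γ.mem_resolventSet_A hdeg h
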